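/- Let $d\ge 2$ and let $f:[0,1)^d\to\mathbb R$ be smooth with a Lipschitz continuous mixed partial of order $d$: the partial derivatives of $f$ up to order $d$ exist on $[0,1)^d$ and there are finite constants $B\ge 0$ and $\beta\in(0,1]$ such that for all $j_1,\dots,j_d\ge 0$ with $j_1+\cdots+j_d=d$ and all $x,y\in[0,1)^d$, $$\Big|\frac{\partial^d f}{\partial x_1^{j_1}\cdots\partial x_d^{j_d}}(x)-\frac{\partial^d f}{\partial x_1^{j_1}\cdots\partial x_d^{j_d}}(y)\Big|\le B\|x-y\|^\beta ,$$ where $\|\cdot\|$ is the Euclidean norm. For $q\ge 1$ let $A=(a_{i,j})\in \mathrm{OA}(q^2,d,q,2)$, that is, $A$ is a $q^2\times d$ array with symbols $0,\dots,q-1$ such that in any two columns each of the $q^2$ possible ordered pairs occurs the same number of times. Let $\pi_1,\dots,\pi_d$ be random permutations of $\{0,\dots,q-1\}$, each uniformly distributed, let $U_{i,j}$ ($1\le i\le q^2$, $1\le j\le d$) be uniform on $[0,1)$, and let all of these be independent. Put $a^*_{i,j}=\pi_j(a_{i,j})$ and $X_i=(X_{i,1},\dots,X_{i,d})$ with $X_{i,j}=(a^*_{i,j}+U_{i,j})/q$.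 Let $A^{**}=(a^{**}_{i,j})$ be obtained from $A^*=(a^*_{i,j})$ by replacing, in each column and for each $k=0,\dots,q-1$, the $q$ entries equal to $k$ by a uniformly random permutation of $kq,kq+1,\dots,(k+1)q-1$, where these permutations are independent of each other and of all the $\pi_j$ and $U_{i,j}$; put $Y_i=(Y_{i,1},\dots,Y_{i,d})$ with $Y_{i,j}=(a^{**}_{i,j}+U_{i,j})/q^2$. Define $$\sigma^2_{oas}=\mathrm{Var}\Big(q^{-2}\sum_{i=1}^{q^2}f(X_i)\Big),\qquad \sigma^2_{oal}=\mathrm{Var}\Big(q^{-2}\sum_{i=1}^{q^2}f(Y_i)\Big).$$ For $u\in\mathbb Z_{\ge0}^d$ and digits $c_{j,k}\in\{0,\dots,q-1\}$ ($1\le j\le d$, $k\ge1$), let $U_u[c]$ be uniformly distributed on $\prod_{j=1}^d\big[\sum_{k=1}^{u_j}c_{j,k}q^{-k},\ q^{-u_j}+\sum_{k=1}^{u_j}c_{j,k}q^{-k}\big)$ and define recursively $$\nu_u[c]=E f(U_u[c])-\sum_{0\preceq v\prec u}\nu_v[c],$$ where $v\preceq u$ means $v_j\le u_j$ for all $j$,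 and $v\prec u$ means $v\preceq u$ and $v\ne u$. Let $|u|=\#\{j:u_j\ge1\}$. For $u\in\{0,1\}^d$ with $\{j:u_j=1\}=\{j_1<\cdots<j_{|u|}\}$ write $\nu^*[\pi_{j_1}(a_{i,j_1});\dots;\pi_{j_{|u|}}(a_{i,j_{|u|}})]$ for $\nu_u[c]$ with first digits $c_{j,1}=\pi_j(a_{i,j})$, and let $$\sigma^2=E\Big\{\Big(\frac1{q^2}\sum_{i=1}^{q^2}\ \sum_{u\in\{0,1\}^d:\,|u|\ge3}\nu^*[\pi_{j_1}(a_{i,j_1});\dots;\pi_{j_{|u|}}(a_{i,j_{|u|}})]\Big)^2\Big\}.$$ Then, as $q\to\infty$ (through those $q$ for which such an array exists), $$\sigma^2_{oal}=\frac1{q^{2}}\sum_{u\in\{0,1\}^d:\,|u|\ge3}E\big\{\nu^*[\pi_{j_1}(a_{1,j_1});\dots;\pi_{j_{|u|}}(a_{1,j_{|u|}})]^2\big\}+O(q^{-3}),$$ $$\sigma^2_{oas}=\sigma^2_{oal}+O(q^{-3}),\qquad \sigma^2=\sigma^2_{oal}+O(q^{-3}),$$ where the constants in the $O$-terms may depend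 on $d$ and $f$ but not on $q$ or on the choice of $A$. -/

import Mathlib

open MeasureTheory ProbabilityTheory

noncomputable section

/-- The half-open unit cube `[0,1)^d`. -/
def cube (d : ℕ) : Set (Fin d → ℝ) := Set.pi Set.univ fun _ => Set.Ico (0 : ℝ) 1

/-- `f : [0,1)^d → ℝ` is smooth with a Lipschitz continuous mixed partial of order `d`: all the
partial derivatives `D m = ∂^{m_1 + ⋯ + m_d} f / ∂x_1^{m_1} ⋯ ∂x_d^{m_d}` of order at most `d` exist
at every point of the cube (one-sided at the faces `x_i = 0`), and for some `B ≥ 0` and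
`β ∈ (0,1]` those of order exactly `d` satisfy `|D m x - D m y| ≤ B ‖x - y‖^β` with the Euclidean
norm. Only the values of `f` on the cube matter. -/
def SmoothLipschitzMixedPartial {d : ℕ} (f : (Fin d → ℝ) → ℝ) : Prop :=
  ∃ D : (Fin d → ℕ) → (Fin d → ℝ) → ℝ,
    (∀ x ∈ cube d, D 0 x = f x) ∧
    (∀ m : Fin d → ℕ, ∑ j, m j < d → ∀ i : Fin d, ∀ x ∈ cube d,
      HasDerivWithinAt (fun s : ℝ => D m (Function.update x i s)) (D (m + Pi.single i 1) x)
        (Set.Ico 0 1) (x i)) ∧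
    ∃ B β : ℝ, 0 ≤ B ∧ 0 < β ∧ β ≤ 1 ∧
      ∀ m : Fin d → ℕ, ∑ j, m j = d → ∀ x ∈ cube d, ∀ y ∈ cube d,
        |D m x - D m y| ≤ B * ‖WithLp.toLp 2 (x - y)‖ ^ β

/-- `A ∈ OA(n, d, q, t)`: an `n × d` matrix with symbols `0, …, q - 1` such that in any `n × t`
submatrix each of the `q^t` possible rows occurs the same number of times. -/
def IsOrthogonalArray {n d q : ℕ} (t : ℕ) (A : Matrix (Fin n) (Fin d) (Fin q)) : Prop :=
  ∃ r : ℕ, ∀ (col : Fin t ↪ Fin d) (v : Fin t → Fin q),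
    (Finset.univ.filter fun i : Fin n => ∀ s, A i (col s) = v s).card = r

/-! ### Random ingredients -/

instance permMeasurableSpace (q : ℕ) : MeasurableSpace (Equiv.Perm (Fin q)) := ⊤

/-- The uniform distribution on the `q!` permutations of `{0, …, q - 1}`. -/
def unifPerm (q : ℕ) : Measure (Equiv.Perm (Fin q)) :=
  (PMF.uniformOfFintype (Equiv.Perm (Fin q))).toMeasure

instance unifPermProb (q : ℕ) : IsProbabilityMeasure (unifPerm q) := by
  unfold unifPerm; infer_instance

/-- The uniform distribution on `[0,1)`. -/
def unifIco : Measure ℝ := volume.restrict (Set.Ico 0 1)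

instance unifIcoProb : IsProbabilityMeasure unifIco := ⟨by simp [unifIco]⟩

/-- The joint law of `π_1, …, π_d`, independent uniform permutations of the symbols. -/
def symbolPermLaw (q d : ℕ) : Measure (Fin d → Equiv.Perm (Fin q)) :=
  Measure.pi fun _ => unifPerm q

instance symbolPermLawProb (q d : ℕ) : IsProbabilityMeasure (symbolPermLaw q d) := by
  unfold symbolPermLaw; infer_instance

/-- The joint law of the independent uniform permutations `τ_{j,k}`, one for each column `j` and
each symbol `k`. -/
def blockPermLaw (q d : ℕ) : Measure (Fin d → Fin q → Equiv.Perm (Fin q)) :=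
  Measure.pi fun _ => Measure.pi fun _ => unifPerm q

instance blockPermLawProb (q d : ℕ) : IsProbabilityMeasure (blockPermLaw q d) := by
  unfold blockPermLaw; infer_instance

/-- The joint law of the independent `[0,1)` uniform variables `U_{i,j}`. -/
def jitterLaw (n d : ℕ) : Measure (Fin n → Fin d → ℝ) :=
  Measure.pi fun _ => Measure.pi fun _ => unifIco

instance jitterLawProb (n d : ℕ) : IsProbabilityMeasure (jitterLaw n d) := by
  unfold jitterLaw; infer_instance

/-- The array `A^*` with entries `a^*_{i,j} = π_j (a_{i,j})`. -/
def randomizeSymbols {n d q : ℕ} (A : Matrix (Fin n) (Fin d) (Fin q))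
    (p : Fin d → Equiv.Perm (Fin q)) : Matrix (Fin n) (Fin d) (Fin q) :=
  fun i j => p j (A i j)

/-! ### Randomized orthogonal array sampling -/

/-- The point `X_i` with `X_{i,j} = (a^*_{i,j} + U_{i,j}) / q`. -/
def pointX {n d q : ℕ} (A : Matrix (Fin n) (Fin d) (Fin q))
    (p : Fin d → Equiv.Perm (Fin q)) (U : Fin n → Fin d → ℝ) (i : Fin n) : Fin d → ℝ :=
  fun j => (((randomizeSymbols A p i j : ℕ) : ℝ) + U i j) / q

/-- `σ²_oas`, the variance of `q^{-2} ∑_i f(X_i)`. -/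
def sigmaSqOas {d q : ℕ} (f : (Fin d → ℝ) → ℝ) (A : Matrix (Fin (q ^ 2)) (Fin d) (Fin q)) : ℝ :=
  variance
    (fun w : (Fin d → Equiv.Perm (Fin q)) × (Fin (q ^ 2) → Fin d → ℝ) =>
      ((q : ℝ) ^ 2)⁻¹ * ∑ i, f (pointX A w.1 w.2 i))
    ((symbolPermLaw q d).prod (jitterLaw (q ^ 2) d))

/-! ### OA-based Latin hypercubes -/

/-- The number of rows above row `i` that have the same entry as row `i` in column `j`. Counting
from `0`, row `i` is the `priorCount M i j`-th position of column `j` that carries its symbol. -/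
def priorCount {n d q : ℕ} (M : Matrix (Fin n) (Fin d) (Fin q)) (i : Fin n) (j : Fin d) : ℕ :=
  (Finset.univ.filter fun i' : Fin n => i' < i ∧ M i' j = M i j).card

/-- In an orthogonal array of strength two with at least two columns, `priorCount` is below `q`. -/
theorem priorCount_lt {d q : ℕ} (hd : 2 ≤ d) (M : Matrix (Fin (q ^ 2)) (Fin d) (Fin q))
    (hM : IsOrthogonalArray 2 M) (i : Fin (q ^ 2)) (j : Fin d) : priorCount M i j < q := by
  obtain ⟨r, hr⟩ := hM
  have : Nontrivial (Fin d) := Fin.nontrivial_iff_two_le.mpr hd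
  obtain ⟨j', hj'⟩ := exists_ne j
  let col : Fin 2 ↪ Fin d := ⟨![j, j'], by
    intro a b hab
    fin_cases a <;> fin_cases b <;> simp_all [eq_comm]⟩
  have hq : 0 < q := (M i j).pos
  have hr1 : r = 1 := by
    have h := Finset.card_eq_sum_card_fiberwise (s := (Finset.univ : Finset (Fin (q ^ 2))))
      (t := (Finset.univ : Finset (Fin 2 → Fin q))) (f := fun i s => M i (col s)) (by simp)
    have h2 : ∀ v : Fin 2 → Fin q,
        (Finset.univ.filter fun i : Fin (q ^ 2) => (fun s => M i (col s)) = v).card = r := by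
      intro v
      rw [← hr col v]
      congr 1
      ext i
      simp [funext_iff]
    simp only [h2] at h
    simp only [Finset.card_univ, Fintype.card_fin, Finset.sum_const, Fintype.card_fun,
      smul_eq_mul] at h
    have hp : 0 < q ^ 2 := by positivity
    nlinarith
  let T := Finset.univ.filter fun i' : Fin (q ^ 2) => M i' j = M i j
  have hT : T.card ≤ q := by
    have h3 : T.card ≤ (Finset.univ : Finset (Fin q)).card := by
      refine Finset.card_le_card_of_injOn (fun i' => M i' j') (by simp) ?_
      intro a ha b hb hab
      simp only [T, Finset.coe_filter, Finset.mem_univ, true_and, Set.mem_ofPred_eq] at ha hb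
      have h4 := hr col ![M i j, M a j']
      rw [hr1] at h4
      refine Finset.card_le_one.mp h4.le a ?_ b ?_
      · simp only [Fin.forall_fin_two, col, Finset.mem_filter, Finset.mem_univ, true_and]
        exact ⟨ha, rfl⟩
      · simp only [Fin.forall_fin_two, col, Finset.mem_filter, Finset.mem_univ, true_and]
        exact ⟨hb, hab.symm⟩
    simpa using h3
  refine lt_of_lt_of_le (Finset.card_lt_card (t := T) ?_) hT
  refine ⟨fun x hx => ?_, fun h => ?_⟩
  · simp only [Finset.mem_filter, Finset.mem_univ, true_and] at hx
    simp [T, hx.2]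
  · have := h (show i ∈ T by simp [T])
    simp at this

/-- The array `A^{**}` made from `M = A^*`: in column `j`, the `q` positions with entry `k` receive,
from top to bottom, `k q + τ_{j,k}(0), …, k q + τ_{j,k}(q - 1)`, that is, a random permutation of
`k q, …, (k + 1) q - 1`. (For an orthogonal array of strength two with at least two columns
`priorCount M i j < q`, so that the reduction modulo `q` in `Fin.ofNat` has no effect.) -/
def latinArray {n d q : ℕ} [NeZero q] (M : Matrix (Fin n) (Fin d) (Fin q))
    (τ : Fin d → Fin q → Equiv.Perm (Fin q)) (i : Fin n) (j : Fin d) : ℕ :=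
  (M i j : ℕ) * q + (τ j (M i j) (Fin.ofNat q (priorCount M i j)) : ℕ)

/-- The point `Y_i` with `Y_{i,j} = (a^{**}_{i,j} + U_{i,j}) / q²`. -/
def pointY {n d q : ℕ} [NeZero q] (A : Matrix (Fin n) (Fin d) (Fin q))
    (p : Fin d → Equiv.Perm (Fin q)) (τ : Fin d → Fin q → Equiv.Perm (Fin q))
    (U : Fin n → Fin d → ℝ) (i : Fin n) : Fin d → ℝ :=
  fun j => ((latinArray (randomizeSymbols A p) τ i j : ℝ) + U i j) / (q : ℝ) ^ 2

/-- `σ²_oal`, the variance of `q^{-2} ∑_i f(Y_i)`. -/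
def sigmaSqOal {d q : ℕ} [NeZero q] (f : (Fin d → ℝ) → ℝ)
    (A : Matrix (Fin (q ^ 2)) (Fin d) (Fin q)) : ℝ :=
  variance
    (fun w : (Fin d → Equiv.Perm (Fin q)) × (Fin d → Fin q → Equiv.Perm (Fin q)) ×
        (Fin (q ^ 2) → Fin d → ℝ) =>
      ((q : ℝ) ^ 2)⁻¹ * ∑ i, f (pointY A w.1 w.2.1 w.2.2 i))
    ((symbolPermLaw q d).prod ((blockPermLaw q d).prod (jitterLaw (q ^ 2) d)))

/-! ### The ANOVA decomposition -/

/-- The cell `∏_j [∑_{k ≤ u_j} c_{j,k} q^{-k}, q^{-u_j} + ∑_{k ≤ u_j} c_{j,k} q^{-k})`.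
The digit `c_{j,k}`, `k ≥ 1`, is `c j (k - 1)`. -/
def qCell {d q : ℕ} (u : Fin d → ℕ) (c : Fin d → ℕ → Fin q) : Set (Fin d → ℝ) :=
  Set.pi Set.univ fun j =>
    Set.Ico (∑ k ∈ Finset.range (u j), ((c j k : ℕ) : ℝ) / (q : ℝ) ^ (k + 1))
      (((q : ℝ) ^ u j)⁻¹ + ∑ k ∈ Finset.range (u j), ((c j k : ℕ) : ℝ) / (q : ℝ) ^ (k + 1))

/-- `ν_u[c]`, defined recursively by
`ν_u[c] = E f(U[c]) - ∑_{0 ⪯ v ≺ u} ν_v[c]`, where `U[c]` is uniform on the cell of `u` and `c`. -/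
def nu {d q : ℕ} (f : (Fin d → ℝ) → ℝ) (c : Fin d → ℕ → Fin q) (u : Fin d → ℕ) : ℝ :=
  (⨍ x in qCell u c, f x) - ∑ v ∈ (Finset.Ico 0 u).attach, nu f c v.1
termination_by ∑ j, u j
decreasing_by
  have h := (Finset.mem_Ico.mp v.2).2
  obtain ⟨hle, j, hj⟩ := Pi.lt_def.mp h
  exact Finset.sum_lt_sum (fun i _ => hle i) ⟨j, Finset.mem_univ j, hj⟩

/-- The index vectors `u ∈ {0,1}^d` with `|u| = #{j : u_j ≥ 1} ≥ 3`. -/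
def highOrder (d : ℕ) : Finset (Fin d → ℕ) :=
  (Finset.Icc 0 1).filter fun u => 3 ≤ (Finset.univ.filter fun j => 1 ≤ u j).card

/-- `ν^*[π_{j_1}(a_{i,j_1}); …; π_{j_{|u|}}(a_{i,j_{|u|}})]` for `u ∈ {0,1}^d`. Only the first digit
of a coordinate `j` with `u_j = 1` enters. -/
def nuStar {n d q : ℕ} (f : (Fin d → ℝ) → ℝ) (A : Matrix (Fin n) (Fin d) (Fin q))
    (p : Fin d → Equiv.Perm (Fin q)) (i : Fin n) (u : Fin d → ℕ) : ℝ :=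
  nu f (fun j _ => p j (A i j)) u

/-- `σ² = E[(q^{-2} ∑_i ∑_{u ∈ {0,1}^d, |u| ≥ 3} ν^*[…])²]`. -/
def sigmaSqProxy {d q : ℕ} (f : (Fin d → ℝ) → ℝ) (A : Matrix (Fin (q ^ 2)) (Fin d) (Fin q)) : ℝ :=
  ∫ p, (((q : ℝ) ^ 2)⁻¹ * ∑ i, ∑ u ∈ highOrder d, nuStar f A p i u) ^ 2 ∂(symbolPermLaw q d)

end

/-! ### Lipschitz continuity of the integrand -/

/-! Condition on the symbol permutations `p`. Each point then has a fixed cell of side `1/q` in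
which it is uniform, and points whose rows share no symbol are independent. This holds for both
schemes: in the Latin one, the second digit `τ` and the remainder `U` together give a uniform
position in the cell. Smoothness enters through one consequence, that `f` is Lipschitz with some
constant `K`, so `f` deviates from its cell mean by at most `K/q`. A row shares a symbol with at
most `d q` rows, so the conditional variance of the average is at most `q⁻⁴ · q² · d q · (K/q)² = d
K² q⁻³` (`OA_conditional_moments`).

The conditional mean is the average of the cell means. Their ANOVA components with `|u| = 1, 2` sum
to zero over the rows, because any two columns show each pair of symbols exactly once
(`mean_cellAvg_eq`). What remains is a constant plus `highOrderSum`, whose second moment is `σ²`. By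
the law of total variance (`abs_variance_prod_sub_le`) both variances are within `d K² q⁻³` of `σ²`.

It remains to expand `σ²` over pairs of rows (`abs_integral_highOrderSum_sq_sub_le`). Different
components are uncorrelated, and equal rows give the stated main term. For distinct rows, every
active column in which they differ contributes a factor `-1/(q-1)` (`integral_permute_mul_update`).
Distinct rows agree in at most one column and `|u| ≥ 3`, so the correlation is `O(q⁻³)` for at most
`q⁴` pairs and `O(q⁻²)` for the at most `d q³` pairs sharing a symbol. With the prefactor `q⁻⁴` both
contributions are `O(q⁻³)`. -/

theorem mem_cube {d : ℕ} {x : Fin d → ℝ} : x ∈ cube d ↔ ∀ j, x j ∈ Set.Ico (0 : ℝ) 1 := by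
  simp [cube]

theorem update_mem_cube {d : ℕ} {x : Fin d → ℝ} (hx : x ∈ cube d) (i : Fin d) {s : ℝ}
    (hs : s ∈ Set.Ico (0 : ℝ) 1) : Function.update x i s ∈ cube d := by
  rw [mem_cube] at hx ⊢
  intro j
  by_cases h : j = i
  · subst h; simpa using hs
  · simpa [h] using hx j

/-- A function that is Lipschitz in each coordinate on the cube is Lipschitz on the cube. -/
theorem abs_sub_le_of_coordinatewise {d : ℕ} {F : (Fin d → ℝ) → ℝ} {C : ℝ} (hC : 0 ≤ C)
    (h : ∀ i, ∀ x ∈ cube d, ∀ s ∈ Set.Ico (0 : ℝ) 1,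
      |F (Function.update x i s) - F x| ≤ C * |s - x i|)
    {x y : Fin d → ℝ} (hx : x ∈ cube d) (hy : y ∈ cube d) :
    |F y - F x| ≤ d * C * ‖y - x‖ := by
  -- Coordinates of `x` are replaced by those of `y` one at a time; the intermediate points stay in
  -- the cube because it is a product.
  have key : ∀ S : Finset (Fin d), |F (S.piecewise y x) - F x| ≤ S.card * (C * ‖y - x‖) := by
    intro S
    induction S using Finset.induction_on with
    | empty => simp
    | insert i S hi ih =>
      rw [Finset.piecewise_insert, Finset.card_insert_of_notMem hi]
      have hmem : S.piecewise y x ∈ cube d := by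
        rw [mem_cube] at hx hy ⊢
        intro j
        by_cases hj : j ∈ S <;> simp [hj, hx j, hy j]
      have h1 := h i _ hmem (y i) (mem_cube.mp hy i)
      rw [Finset.piecewise_eq_of_notMem _ _ _ hi] at h1
      have h2 : |y i - x i| ≤ ‖y - x‖ := by
        simpa using norm_le_pi_norm (y - x) i
      have h3 := abs_sub_le (F (Function.update (S.piecewise y x) i (y i)))
        (F (S.piecewise y x)) (F x)
      have h4 := mul_le_mul_of_nonneg_left h2 hC
      push_cast
      linarith
  have := key Finset.univ
  simp only [Finset.piecewise_univ, Finset.card_univ, Fintype.card_fin] at this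
  linarith

theorem coordinatewise_of_hasDerivWithinAt {d : ℕ} {F : (Fin d → ℝ) → ℝ}
    {F' : Fin d → (Fin d → ℝ) → ℝ} {C : ℝ}
    (hF : ∀ i : Fin d, ∀ x ∈ cube d,
      HasDerivWithinAt (fun s : ℝ => F (Function.update x i s)) (F' i x) (Set.Ico 0 1) (x i))
    (hC : ∀ i, ∀ x ∈ cube d, |F' i x| ≤ C) (i : Fin d) (x : Fin d → ℝ) (hx : x ∈ cube d) (s : ℝ)
    (hs : s ∈ Set.Ico (0 : ℝ) 1) :
    |F (Function.update x i s) - F x| ≤ C * |s - x i| := by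
  have := (convex_Ico (0 : ℝ) 1).norm_image_sub_le_of_norm_hasDerivWithin_le
    (f := fun s => F (Function.update x i s)) (f' := fun s => F' i (Function.update x i s))
    (C := C) (x := x i) (y := s) ?_ ?_ (mem_cube.mp hx i) hs
  · simpa using this
  · intro t ht
    simpa using hF i _ (update_mem_cube hx i ht)
  · intro t ht
    exact hC i _ (update_mem_cube hx i ht)

theorem norm_toLp_sub_le {d : ℕ} {x y : Fin d → ℝ} (hx : x ∈ cube d) (hy : y ∈ cube d) :
    ‖WithLp.toLp 2 (x - y)‖ ≤ √d := by
  rw [EuclideanSpace.norm_eq]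
  apply Real.sqrt_le_sqrt
  calc _ ≤ ∑ _j : Fin d, (1 : ℝ) := by
        refine Finset.sum_le_sum fun j _ => ?_
        have h1 := mem_cube.mp hx j
        have h2 := mem_cube.mp hy j
        simp only [Set.mem_Ico] at h1 h2
        simp only [Pi.sub_apply, Real.norm_eq_abs, sq_abs]
        rw [sq_le_one_iff_abs_le_one, abs_le]
        constructor <;> linarith
    _ = d := by simp

/-- Boundedness descends through the orders: the Hölder condition on a bounded set bounds the
partials of order `d`, and bounded partials of one order make those of the order below Lipschitz,
hence bounded. At order `0` this is the Lipschitz bound for `f`. -/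
theorem SmoothLipschitzMixedPartial.exists_lipschitz {d : ℕ} (hd : 1 ≤ d) {f : (Fin d → ℝ) → ℝ}
    (hf : SmoothLipschitzMixedPartial f) :
    ∃ K : ℝ, 0 ≤ K ∧ ∀ x ∈ cube d, ∀ y ∈ cube d, |f x - f y| ≤ K * ‖x - y‖ := by
  obtain ⟨D, hD0, hD, B, β, hB, hβ, -, hH⟩ := hf
  have h0 : (0 : Fin d → ℝ) ∈ cube d := by simp [mem_cube]
  have bound_of : ∀ {F : (Fin d → ℝ) → ℝ} {C : ℝ},
      (∀ x ∈ cube d, |F x - F 0| ≤ C) → ∃ C, 0 ≤ C ∧ ∀ x ∈ cube d, |F x| ≤ C := by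
    intro F C h
    refine ⟨C + |F 0|, ?_, fun x hx => ?_⟩
    · have := (abs_nonneg _).trans (h 0 h0)
      positivity
    · have := h x hx
      have := abs_sub_abs_le_abs_sub (F x) (F 0)
      linarith
  have step : ∀ m : Fin d → ℕ, ∑ j, m j < d →
      (∀ i, ∃ C, 0 ≤ C ∧ ∀ x ∈ cube d, |D (m + Pi.single i 1) x| ≤ C) →
      ∃ K : ℝ, 0 ≤ K ∧ ∀ x ∈ cube d, ∀ y ∈ cube d, |D m x - D m y| ≤ K * ‖x - y‖ := by
    intro m hm hb
    choose C hC0 hC using hb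
    have hS : 0 ≤ ∑ i, C i := Finset.sum_nonneg fun i _ => hC0 i
    refine ⟨d * ∑ i, C i, by positivity, fun x hx y hy => ?_⟩
    refine abs_sub_le_of_coordinatewise hS ?_ hy hx
    refine coordinatewise_of_hasDerivWithinAt (F' := fun i => D (m + Pi.single i 1)) (hD m hm) ?_
    intro i x hx
    exact (hC i x hx).trans (Finset.single_le_sum (fun j _ => hC0 j) (Finset.mem_univ i))
  have norm_le : ∀ x ∈ cube d, ‖x - 0‖ ≤ 1 := by
    intro x hx
    rw [pi_norm_le_iff_of_nonneg zero_le_one]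
    intro j
    have := mem_cube.mp hx j
    simp only [Set.mem_Ico] at this
    simp only [sub_zero, Real.norm_eq_abs, abs_le]
    constructor <;> linarith
  have sum_single : ∀ (m : Fin d → ℕ) i, ∑ j, (m + Pi.single i 1 : Fin d → ℕ) j = ∑ j, m j + 1 := by
    intro m i
    simp [Finset.sum_add_distrib]
  -- The induction runs on the codimension `k = d - |m|`, starting at the top order.
  have bdd : ∀ k : ℕ, ∀ m : Fin d → ℕ, ∑ j, m j + k = d →
      ∃ C, 0 ≤ C ∧ ∀ x ∈ cube d, |D m x| ≤ C := by
    intro k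
    induction k with
    | zero =>
      intro m hm
      refine bound_of (C := B * √d ^ β) fun x hx => ?_
      refine (hH m (by simpa using hm) x hx 0 h0).trans ?_
      gcongr
      exact norm_toLp_sub_le hx h0
    | succ k ih =>
      intro m hm
      obtain ⟨K, hK, h⟩ := step m (by omega) fun i => ih _ (by rw [sum_single]; omega)
      refine bound_of (C := K) fun x hx => (h x hx 0 h0).trans ?_
      exact mul_le_of_le_one_right hK (norm_le x hx)
  obtain ⟨K, hK, h⟩ := step 0 (by simp; omega) fun i =>
    bdd (d - 1) _ (by rw [sum_single]; simp; omega)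
  refine ⟨K, hK, fun x hx y hy => ?_⟩
  rw [← hD0 x hx, ← hD0 y hy]
  exact h x hx y hy

/-- The integrand agrees on the cube with a bounded Lipschitz function on the whole space. -/
theorem SmoothLipschitzMixedPartial.exists_extension {d : ℕ} (hd : 1 ≤ d) {f : (Fin d → ℝ) → ℝ}
    (hf : SmoothLipschitzMixedPartial f) :
    ∃ (g : (Fin d → ℝ) → ℝ) (K : NNReal) (B : ℝ), LipschitzWith K g ∧ (∀ x, |g x| ≤ B) ∧
      Set.EqOn f g (cube d) := by
  obtain ⟨K, hK, h⟩ := hf.exists_lipschitz hd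
  have hL : LipschitzOnWith ⟨K, hK⟩ f (cube d) := by
    refine LipschitzOnWith.of_dist_le_mul fun x hx y hy => ?_
    rw [dist_eq_norm, dist_eq_norm, Real.norm_eq_abs]
    exact h x hx y hy
  obtain ⟨g, hg, hfg⟩ := hL.extend_real
  have h0 : (0 : Fin d → ℝ) ∈ cube d := by simp [mem_cube]
  set B : ℝ := K + |f 0|
  have hB : 0 ≤ B := by positivity
  -- Truncating the Lipschitz extension at `±B` makes it bounded without changing it on the cube,
  -- where `|f| ≤ K + |f 0|` since the sup norm there is at most `1`.
  refine ⟨fun x => max (-B) (min B (g x)), _, B, (hg.const_min B).const_max (-B), fun x => ?_,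
    fun x hx => ?_⟩
  · rw [abs_le]
    exact ⟨le_max_left _ _, max_le (by linarith) (min_le_left _ _)⟩
  · have h1 : |f x| ≤ B := by
      have h2 := h x hx 0 h0
      have h3 : ‖x - 0‖ ≤ 1 := by
        rw [pi_norm_le_iff_of_nonneg zero_le_one]
        intro j
        have := mem_cube.mp hx j
        simp only [Set.mem_Ico] at this
        simp only [sub_zero, Real.norm_eq_abs, abs_le]
        constructor <;> linarith
      have h4 := mul_le_of_le_one_right hK h3
      have := abs_sub_abs_le_abs_sub (f x) (f 0)
      simp only [B]
      linarith
    rw [abs_le] at h1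
    simp only [← hfg hx]
    rw [min_eq_right h1.2, max_eq_right h1.1]

/-! ### Cells of the `q`-adic partition and the ANOVA components of order at most one per axis -/

theorem Ico_div_disjoint {q : ℕ} {k l : Fin q} (h : k ≠ l) :
    Disjoint (Set.Ico ((k : ℕ) / q : ℝ) (((k : ℕ) + 1) / q))
      (Set.Ico ((l : ℕ) / q : ℝ) (((l : ℕ) + 1) / q)) := by
  have hq : (0 : ℝ) < q := by exact_mod_cast k.pos
  rw [Set.disjoint_left]
  intro x hx hy
  simp only [Set.mem_Ico, div_le_iff₀ hq, lt_div_iff₀ hq] at hx hy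
  apply h
  have h1 : (k : ℕ) < (l : ℕ) + 1 := by exact_mod_cast lt_of_le_of_lt hx.1 hy.2
  have h2 : (l : ℕ) < (k : ℕ) + 1 := by exact_mod_cast lt_of_le_of_lt hy.1 hx.2
  ext
  omega

theorem iUnion_Ico_div {q : ℕ} [NeZero q] :
    ⋃ k : Fin q, Set.Ico ((k : ℕ) / q : ℝ) (((k : ℕ) + 1) / q) = Set.Ico 0 1 := by
  have hq : (0 : ℝ) < q := by exact_mod_cast NeZero.pos q
  ext x
  simp only [Set.mem_iUnion, Set.mem_Ico, div_le_iff₀ hq, lt_div_iff₀ hq]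
  constructor
  · rintro ⟨k, h1, h2⟩
    have h3 : ((k : ℕ) : ℝ) + 1 ≤ q := by exact_mod_cast k.isLt
    have h4 : (0 : ℝ) ≤ (k : ℕ) := by positivity
    constructor
    · by_contra! h
      nlinarith
    · by_contra! h
      nlinarith
  · rintro ⟨h1, h2⟩
    have h3 : 0 ≤ x * q := by positivity
    refine ⟨⟨⌊x * q⌋₊, ?_⟩, Nat.floor_le h3, Nat.lt_floor_add_one _⟩
    rw [Nat.floor_lt h3]
    nlinarith

/-- The cell `qCell u c` for digits `c j k = a j` not depending on `k`. -/
abbrev cell {d q : ℕ} (u : Fin d → ℕ) (a : Fin d → Fin q) : Set (Fin d → ℝ) :=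
  qCell u fun j _ => a j

theorem mem_cell {d q : ℕ} {u : Fin d → ℕ} (hu : u ≤ 1) {a : Fin d → Fin q} {x : Fin d → ℝ} :
    x ∈ cell u a ↔ ∀ j, x j ∈ if u j = 0 then Set.Ico (0 : ℝ) 1 else
      Set.Ico (((a j : ℕ) : ℝ) / q) (((a j : ℕ) + 1) / q) := by
  simp only [cell, qCell, Set.mem_univ_pi]
  refine forall_congr' fun j => ?_
  have : u j = 0 ∨ u j = 1 := by have := hu j; simp at this; omega
  rcases this with h | h
  · simp [h]
  · simp [h, add_div, add_comm]

theorem measurableSet_cell {d q : ℕ} (u : Fin d → ℕ) (a : Fin d → Fin q) :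
    MeasurableSet (cell u a) :=
  MeasurableSet.univ_pi fun _ => measurableSet_Ico

theorem cell_subset_cube {d q : ℕ} [NeZero q] {u : Fin d → ℕ} (hu : u ≤ 1) (a : Fin d → Fin q) :
    cell u a ⊆ cube d := by
  intro x hx
  rw [mem_cell hu] at hx
  rw [mem_cube]
  intro j
  have := hx j
  split_ifs at this
  · exact this
  · rw [← iUnion_Ico_div (q := q)]
    exact Set.mem_iUnion.mpr ⟨a j, this⟩

theorem volume_real_cell {d q : ℕ} (u : Fin d → ℕ) (a : Fin d → Fin q) :
    volume.real (cell u a) = ∏ j, ((q : ℝ) ^ u j)⁻¹ := by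
  simp only [measureReal_def, cell, qCell, Real.volume_pi_Ico, ENNReal.toReal_prod]
  refine Finset.prod_congr rfl fun j _ => ?_
  rw [add_sub_cancel_right, ENNReal.toReal_ofReal (by positivity)]

/-- The average of `f` over a cell. -/
noncomputable def cellAvg {d q : ℕ} (f : (Fin d → ℝ) → ℝ) (a : Fin d → Fin q) (u : Fin d → ℕ) : ℝ :=
  ⨍ x in cell u a, f x

theorem cellAvg_eq {d q : ℕ} (f : (Fin d → ℝ) → ℝ) (a : Fin d → Fin q) (u : Fin d → ℕ) :
    cellAvg f a u = (∏ j, (q : ℝ) ^ u j) * ∫ x in cell u a, f x := by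
  rw [cellAvg, setAverage_eq, volume_real_cell, smul_eq_mul, Finset.prod_inv_distrib, inv_inv]

theorem iUnion_cell_update {d q : ℕ} [NeZero q] {u : Fin d → ℕ} (hu : u ≤ 1) {j : Fin d}
    (hj : u j = 1) (a : Fin d → Fin q) :
    ⋃ s, cell u (Function.update a j s) = cell (Function.update u j 0) a := by
  have hu0 : Function.update u j 0 ≤ 1 := by
    intro i
    by_cases h : i = j
    · subst h; simp
    · simpa [h] using hu i
  ext x
  simp only [Set.mem_iUnion, mem_cell hu, mem_cell hu0]
  constructor
  · rintro ⟨s, hs⟩ i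
    have := hs i
    by_cases h : i = j
    · subst h
      simp only [hj, one_ne_zero, if_false, Function.update_self] at this
      simp only [Function.update_self, if_true]
      rw [← iUnion_Ico_div (q := q)]
      exact Set.mem_iUnion.mpr ⟨s, this⟩
    · simpa [h] using this
  · intro hx
    have h1 := hx j
    simp only [Function.update_self, if_true] at h1
    rw [← iUnion_Ico_div (q := q)] at h1
    obtain ⟨s, hs⟩ := Set.mem_iUnion.mp h1
    refine ⟨s, fun i => ?_⟩
    by_cases h : i = j
    · subst h
      simpa [hj] using hs
    · simpa [h] using hx i

theorem disjoint_cell_update {d q : ℕ} {u : Fin d → ℕ} (hu : u ≤ 1) {j : Fin d} (hj : u j = 1)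
    (a : Fin d → Fin q) :
    Pairwise (Function.onFun Disjoint fun s => cell u (Function.update a j s)) := by
  intro s t hst
  rw [Function.onFun, Set.disjoint_left]
  intro x hx hy
  have h1 := (mem_cell hu).mp hx j
  have h2 := (mem_cell hu).mp hy j
  simp only [hj, one_ne_zero, if_false, Function.update_self] at h1 h2
  exact Set.disjoint_left.mp (Ico_div_disjoint hst) h1 h2

theorem volume_cell_ne_top {d q : ℕ} (u : Fin d → ℕ) (a : Fin d → Fin q) :
    volume (cell u a) ≠ ⊤ := by
  simp only [cell, qCell, Real.volume_pi_Ico]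
  exact ENNReal.prod_ne_top fun j _ => ENNReal.ofReal_ne_top

/-- The `q` cells obtained by varying digit `j` tile the cell that is unrestricted in direction `j`,
and each has `1/q` of its volume. -/
theorem sum_cellAvg_update {d q : ℕ} [NeZero q] {f : (Fin d → ℝ) → ℝ} (hf : LocallyIntegrable f)
    {u : Fin d → ℕ} (hu : u ≤ 1) {j : Fin d} (hj : u j = 1) (a : Fin d → Fin q) :
    ∑ s, cellAvg f (Function.update a j s) u = q * cellAvg f a (Function.update u j 0) := by
  have hint : ∀ s, IntegrableOn f (cell u (Function.update a j s)) := fun s =>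
    (hf.integrableOn_isCompact (isCompact_univ_pi fun _ => isCompact_Icc)).mono_set
      ((Set.pi_mono fun _ _ => Set.Ico_subset_Icc_self))
  simp only [cellAvg_eq, ← Finset.mul_sum]
  rw [← integral_iUnion_fintype (fun s => measurableSet_cell u _) (disjoint_cell_update hu hj a)
    hint, iUnion_cell_update hu hj, ← mul_assoc]
  congr 1
  rw [← Finset.mul_prod_erase _ _ (Finset.mem_univ j), hj, pow_one,
    ← Finset.mul_prod_erase Finset.univ (fun i => (q : ℝ) ^ (Function.update u j 0) i)
      (Finset.mem_univ j), Function.update_self, pow_zero, one_mul]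
  congr 1
  refine Finset.prod_congr rfl fun i hi => ?_
  rw [Function.update_of_ne (Finset.ne_of_mem_erase hi)]

/-- `nu` for digits not depending on the level. -/
noncomputable abbrev anova {d q : ℕ} (f : (Fin d → ℝ) → ℝ) (a : Fin d → Fin q) (u : Fin d → ℕ) : ℝ :=
  nu f (fun j _ => a j) u

theorem anova_eq {d q : ℕ} (f : (Fin d → ℝ) → ℝ) (a : Fin d → Fin q) (u : Fin d → ℕ) :
    anova f a u = cellAvg f a u - ∑ v ∈ Finset.Ico 0 u, anova f a v := by
  rw [anova, nu, Finset.sum_attach (Finset.Ico 0 u) fun v => nu f (fun j _ => a j) v]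
  rfl

/-- The recursion solved for the cell mean; at `u = 1` it is the ANOVA expansion of the mean over a
full cell. -/
theorem sum_anova {d q : ℕ} (f : (Fin d → ℝ) → ℝ) (a : Fin d → Fin q) (u : Fin d → ℕ) :
    ∑ v ∈ Finset.Icc 0 u, anova f a v = cellAvg f a u := by
  rw [Finset.Icc_eq_cons_Ico (zero_le), Finset.sum_cons, anova_eq f a u]
  ring

theorem cellAvg_congr {d q : ℕ} (f : (Fin d → ℝ) → ℝ) {a b : Fin d → Fin q} {u : Fin d → ℕ}
    (h : ∀ j, u j ≠ 0 → a j = b j) : cellAvg f a u = cellAvg f b u := by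
  have : cell u a = cell u b := by
    refine Set.pi_congr rfl fun j _ => ?_
    by_cases hj : u j = 0
    · simp [hj]
    · simp [h j hj]
  simp only [cellAvg, this]

theorem anova_congr {d q : ℕ} (f : (Fin d → ℝ) → ℝ) {a b : Fin d → Fin q} {u : Fin d → ℕ}
    (h : ∀ j, u j ≠ 0 → a j = b j) : anova f a u = anova f b u := by
  induction u using WellFoundedLT.induction with
  | ind u ih =>
    rw [anova_eq, anova_eq, cellAvg_congr f h]
    congr 1
    refine Finset.sum_congr rfl fun v hv => ih v (Finset.mem_Ico.mp hv).2 fun j hj => h j ?_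
    have : v j ≤ u j := (Finset.mem_Ico.mp hv).2.le j
    omega

theorem anova_congr_fun {d q : ℕ} [NeZero q] {f g : (Fin d → ℝ) → ℝ} (h : Set.EqOn f g (cube d))
    (a : Fin d → Fin q) {u : Fin d → ℕ} (hu : u ≤ 1) : anova f a u = anova g a u := by
  induction u using WellFoundedLT.induction with
  | ind u ih =>
    rw [anova_eq, anova_eq]
    congr 1
    · exact setAverage_congr_fun (measurableSet_cell u a)
        (Filter.Eventually.of_forall fun x hx => h (cell_subset_cube hu a hx))
    · refine Finset.sum_congr rfl fun v hv => ?_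
      exact ih v (Finset.mem_Ico.mp hv).2 ((Finset.mem_Ico.mp hv).2.le.trans hu)

theorem abs_cellAvg_le {d q : ℕ} [NeZero q] {f : (Fin d → ℝ) → ℝ} {B : ℝ}
    (hB : ∀ x, |f x| ≤ B) (a : Fin d → Fin q) (u : Fin d → ℕ) : |cellAvg f a u| ≤ B := by
  have hq : (0 : ℝ) < q := by exact_mod_cast NeZero.pos q
  have h := norm_setIntegral_le_of_norm_le_const (μ := volume) (s := cell u a) (f := f) (C := B)
    (volume_cell_ne_top u a).lt_top fun x _ => hB x
  rw [cellAvg_eq, abs_mul, abs_of_nonneg (by positivity)]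
  rw [volume_real_cell, Real.norm_eq_abs] at h
  refine (mul_le_mul_of_nonneg_left h (by positivity)).trans_eq ?_
  rw [mul_left_comm, ← Finset.prod_mul_distrib]
  simp [hq.ne']

/-- The constant is fixed before `q`; this is what makes the final `O`-constants independent of `q`.
-/
theorem exists_abs_anova_le {d : ℕ} {f : (Fin d → ℝ) → ℝ} {B : ℝ} (hB : ∀ x, |f x| ≤ B)
    (u : Fin d → ℕ) :
    ∃ C, ∀ (q : ℕ) [NeZero q] (a : Fin d → Fin q), |anova f a u| ≤ C := by
  induction u using WellFoundedLT.induction with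
  | ind u ih =>
    choose! C hC using ih
    refine ⟨B + ∑ v ∈ Finset.Ico 0 u, C v, fun q _ a => ?_⟩
    rw [anova_eq]
    refine (abs_sub _ _).trans (add_le_add (abs_cellAvg_le hB a u) ?_)
    refine (Finset.abs_sum_le_sum_abs _ _).trans (Finset.sum_le_sum fun v hv => ?_)
    exact hC v (Finset.mem_Ico.mp hv).2 q a

/-- An ANOVA component averages to zero over every digit it depends on. -/
theorem sum_anova_update {d q : ℕ} [NeZero q] {f : (Fin d → ℝ) → ℝ} (hf : LocallyIntegrable f)
    {u : Fin d → ℕ} (hu : u ≤ 1) {j : Fin d} (hj : u j = 1) (a : Fin d → Fin q) :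
    ∑ s, anova f (Function.update a j s) u = 0 := by
  induction u using WellFoundedLT.induction with
  | ind u ih =>
    simp only [anova_eq f _ u, Finset.sum_sub_distrib]
    rw [sum_cellAvg_update hf hu hj, Finset.sum_comm, ← sum_anova, Finset.mul_sum, sub_eq_zero]
    -- The terms `v ≺ u` split by `v j`. Those with `v j = 0` do not depend on `s` and are exactly
    -- the expansion of the mean over the cell merged along `j`, so they cancel it. Those with `v j
    -- = 1` vanish by induction.
    have hsub : Finset.Icc 0 (Function.update u j 0) ⊆ Finset.Ico 0 u := by
      intro v hv
      have hv := (Finset.mem_Icc.mp hv).2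
      refine Finset.mem_Ico.mpr ⟨zero_le, lt_of_le_of_ne (hv.trans ?_) ?_⟩
      · rw [update_le_iff]
        simp
      · rintro rfl
        have := hv j
        simp [hj] at this
    rw [← Finset.sum_subset hsub]
    · refine Finset.sum_congr rfl fun v hv => ?_
      have hvj : v j = 0 := by simpa using (Finset.mem_Icc.mp hv).2 j
      rw [Finset.sum_congr rfl fun s _ => anova_congr f (u := v) (b := a) fun i hi => ?_]
      · simp
      · have : i ≠ j := by rintro rfl; exact hi hvj
        simp [this]
    · intro v hv hv'
      have hvu := (Finset.mem_Ico.mp hv).2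
      refine ih v hvu (hvu.le.trans hu) ?_
      by_contra hne
      refine hv' (Finset.mem_Icc.mpr ⟨zero_le, fun i => ?_⟩)
      by_cases h : i = j
      · subst h
        have h1 : v i ≤ u i := hvu.le i
        simp only [Function.update_self]
        omega
      · simpa [h] using hvu.le i

/-! ### Expectations over independent random permutations of the symbols -/

instance permMeasurableSingletonClass (q : ℕ) : MeasurableSingletonClass (Equiv.Perm (Fin q)) :=
  ⟨fun _ => trivial⟩

theorem unifPerm_singleton {q : ℕ} (σ : Equiv.Perm (Fin q)) :
    unifPerm q {σ} = (Fintype.card (Equiv.Perm (Fin q)) : ENNReal)⁻¹ := by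
  rw [unifPerm, PMF.toMeasure_apply_singleton _ _ (measurableSet_singleton _),
    PMF.uniformOfFintype_apply]

theorem measurePreserving_mul_right_unifPerm {q : ℕ} (τ : Equiv.Perm (Fin q)) :
    MeasurePreserving (fun σ => σ * τ) (unifPerm q) (unifPerm q) := by
  refine ⟨.of_discrete, Measure.ext_of_singleton fun σ => ?_⟩
  rw [Measure.map_apply .of_discrete (measurableSet_singleton _)]
  have : (fun σ => σ * τ) ⁻¹' {σ} = {σ * τ⁻¹} := by
    ext ρ
    simp [eq_mul_inv_iff_mul_eq]
  rw [this, unifPerm_singleton, unifPerm_singleton]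

theorem measurePreserving_mul_left_unifPerm {q : ℕ} (τ : Equiv.Perm (Fin q)) :
    MeasurePreserving (fun σ => τ * σ) (unifPerm q) (unifPerm q) := by
  refine ⟨.of_discrete, Measure.ext_of_singleton fun σ => ?_⟩
  rw [Measure.map_apply .of_discrete (measurableSet_singleton _)]
  have : (fun σ => τ * σ) ⁻¹' {σ} = {τ⁻¹ * σ} := by
    ext ρ
    simp [eq_inv_mul_iff_mul_eq]
  rw [this, unifPerm_singleton, unifPerm_singleton]

theorem integrable_symbolPermLaw {q d : ℕ} (F : (Fin d → Equiv.Perm (Fin q)) → ℝ) :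
    Integrable F (symbolPermLaw q d) := .of_finite

theorem integral_symbolPermLaw_mul_right {q d : ℕ} (F : (Fin d → Equiv.Perm (Fin q)) → ℝ)
    (τ : Fin d → Equiv.Perm (Fin q)) :
    ∫ p, F (p * τ) ∂symbolPermLaw q d = ∫ p, F p ∂symbolPermLaw q d := by
  have : MeasurePreserving (fun p => p * τ) (symbolPermLaw q d) (symbolPermLaw q d) :=
    measurePreserving_pi _ _ fun j => measurePreserving_mul_right_unifPerm (τ j)
  exact this.integral_comp'
    (f := MeasurableEquiv.mk (Equiv.mulRight τ) .of_discrete .of_discrete) F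

/-- The row `p_1(a_1), …, p_d(a_d)`. -/
def permute {q d : ℕ} (p : Fin d → Equiv.Perm (Fin q)) (a : Fin d → Fin q) : Fin d → Fin q :=
  fun j => p j (a j)

theorem permute_mul {q d : ℕ} (p τ : Fin d → Equiv.Perm (Fin q)) (a : Fin d → Fin q) :
    permute (p * τ) a = permute p (permute τ a) := rfl

theorem permute_update {q d : ℕ} (p : Fin d → Equiv.Perm (Fin q)) (a : Fin d → Fin q) (j : Fin d)
    (s : Fin q) : permute p (Function.update a j s) = Function.update (permute p a) j (p j s) := by
  ext i
  by_cases h : i = j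
  · subst h; simp [permute]
  · simp [permute, h]

theorem permute_single_swap {q d : ℕ} (a : Fin d → Fin q) (j : Fin d) (s : Fin q) :
    permute (Pi.mulSingle j (Equiv.swap (a j) s)) a = Function.update a j s := by
  ext i
  by_cases h : i = j
  · subst h; simp [permute]
  · simp [permute, h]

theorem sum_permute_update {q d : ℕ} {F : (Fin d → Fin q) → ℝ} {j : Fin d}
    (hF : ∀ a, ∑ s, F (Function.update a j s) = 0) (p : Fin d → Equiv.Perm (Fin q))
    (a : Fin d → Fin q) : ∑ s, F (permute p (Function.update a j s)) = 0 := by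
  simp only [permute_update]
  rw [Equiv.sum_comp (p j) fun s => F (Function.update (permute p a) j s)]
  exact hF _

theorem integral_permute_eq {q d : ℕ} (F : (Fin d → Fin q) → ℝ) (a b : Fin d → Fin q) :
    ∫ p, F (permute p a) ∂symbolPermLaw q d = ∫ p, F (permute p b) ∂symbolPermLaw q d := by
  rw [← integral_symbolPermLaw_mul_right (fun p => F (permute p a))
    (fun j => Equiv.swap (a j) (b j))]
  simp only [permute_mul]
  congr! 4
  ext j
  simp [permute]

/-- If `F` averages to zero over coordinate `j` and `H` does not depend on it, then `F` and `H` are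
uncorrelated. -/
theorem integral_permute_mul_eq_zero {q d : ℕ} {F H : (Fin d → Fin q) → ℝ} {j : Fin d}
    (hF : ∀ a, ∑ s, F (Function.update a j s) = 0) (hH : ∀ a s, H (Function.update a j s) = H a)
    (a b : Fin d → Fin q) :
    ∫ p, F (permute p a) * H (permute p b) ∂symbolPermLaw q d = 0 := by
  have hq : (q : ℝ) ≠ 0 := by exact_mod_cast (a j).pos.ne'
  -- Swapping `a j` and `s` inside the uniform permutation of column `j` turns `a j` into `s`. It
  -- may also move `b j`, but `H` does not see that coordinate. The expectation is therefore the
  -- same for all `s`, while the sum over `s` is zero.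
  have h : ∀ s, ∫ p, F (permute p (Function.update a j s)) * H (permute p b) ∂symbolPermLaw q d =
      ∫ p, F (permute p a) * H (permute p b) ∂symbolPermLaw q d := by
    intro s
    rw [← integral_symbolPermLaw_mul_right (fun p => F (permute p a) * H (permute p b))
      (Pi.mulSingle j (Equiv.swap (a j) s))]
    simp only [permute_mul, permute_single_swap]
    refine integral_congr_ae (.of_forall fun p => ?_)
    have : permute (Pi.mulSingle j (Equiv.swap (a j) s)) b =
        Function.update b j (Equiv.swap (a j) s (b j)) := by
      ext i
      by_cases h : i = j
      · subst h; simp [permute]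
      · simp [permute, h]
    simp only [this, permute_update, hH]
  have h2 : ∑ s, ∫ p, F (permute p (Function.update a j s)) * H (permute p b)
      ∂symbolPermLaw q d = 0 := by
    rw [← integral_finsetSum _ fun s _ => integrable_symbolPermLaw _]
    simp only [← Finset.sum_mul, sum_permute_update hF, zero_mul, integral_zero]
  simpa [h, hq] using h2

/-- If `F` averages to zero over coordinate `j`, in which the rows `a` and `b` differ, then replacing
the entry `a j` by `b j` multiplies the correlation by `-(q - 1)`. -/
theorem integral_permute_mul_update {q d : ℕ} {F : (Fin d → Fin q) → ℝ}
    (H : (Fin d → Fin q) → ℝ) {j : Fin d}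
    (hF : ∀ a, ∑ s, F (Function.update a j s) = 0) {a b : Fin d → Fin q} (hab : a j ≠ b j) :
    ∫ p, F (permute p (Function.update a j (b j))) * H (permute p b) ∂symbolPermLaw q d =
      -((q : ℝ) - 1) * ∫ p, F (permute p a) * H (permute p b) ∂symbolPermLaw q d := by
  -- The swap of `a j` and `s` now fixes `b j`, which differs from both. So the `q - 1` values `s ≠
  -- b j` give equal expectations, and together with the one at `s = b j` they sum to zero.
  have h : ∀ s ∈ Finset.univ.erase (b j),
      ∫ p, F (permute p (Function.update a j s)) * H (permute p b) ∂symbolPermLaw q d =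
      ∫ p, F (permute p a) * H (permute p b) ∂symbolPermLaw q d := by
    intro s hs
    rw [← integral_symbolPermLaw_mul_right (fun p => F (permute p a) * H (permute p b))
      (Pi.mulSingle j (Equiv.swap (a j) s))]
    simp only [permute_mul, permute_single_swap]
    refine integral_congr_ae (.of_forall fun p => ?_)
    have : permute (Pi.mulSingle j (Equiv.swap (a j) s)) b = b := by
      ext i
      by_cases h : i = j
      · subst h
        simp [permute, Equiv.swap_apply_of_ne_of_ne hab.symm (Finset.ne_of_mem_erase hs).symm]
      · simp [permute, h]
    simp only [this]
  have h2 : ∑ s, ∫ p, F (permute p (Function.update a j s)) * H (permute p b)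
      ∂symbolPermLaw q d = 0 := by
    rw [← integral_finsetSum _ fun s _ => integrable_symbolPermLaw _]
    simp only [← Finset.sum_mul, sum_permute_update hF, zero_mul, integral_zero]
  rw [← Finset.add_sum_erase _ _ (Finset.mem_univ (b j)), Finset.sum_congr rfl h] at h2
  have hq : 1 ≤ q := (a j).pos
  simp only [Finset.sum_const, Finset.card_erase_of_mem (Finset.mem_univ _), Finset.card_univ,
    Fintype.card_fin, nsmul_eq_mul, Nat.cast_sub hq, Nat.cast_one] at h2
  linarith

/-- Each column of `T` gains one factor `1/(q-1)`; once all are spent, the trivial bound `C ^ 2`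
remains. -/
theorem abs_integral_permute_mul_le {q d : ℕ} (hq : 2 ≤ q) {F H : (Fin d → Fin q) → ℝ} {C : ℝ}
    (hFC : ∀ a, |F a| ≤ C) (hHC : ∀ a, |H a| ≤ C) (T : Finset (Fin d))
    (hF : ∀ j ∈ T, ∀ a, ∑ s, F (Function.update a j s) = 0) {a b : Fin d → Fin q}
    (hab : ∀ j ∈ T, a j ≠ b j) :
    |∫ p, F (permute p a) * H (permute p b) ∂symbolPermLaw q d| ≤
      C ^ 2 * (((q : ℝ) - 1)⁻¹) ^ T.card := by
  have hq' : (0 : ℝ) < q - 1 := by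
    have : (2 : ℝ) ≤ q := by exact_mod_cast hq
    linarith
  induction T using Finset.induction_on generalizing a with
  | empty =>
    have := norm_integral_le_of_norm_le_const (μ := symbolPermLaw q d)
      (f := fun p => F (permute p a) * H (permute p b)) (C := C ^ 2) (.of_forall fun p => by
        rw [norm_mul, sq]
        exact mul_le_mul (hFC _) (hHC _) (norm_nonneg _) ((abs_nonneg _).trans (hFC a)))
    simpa using this
  | insert j T hj ih =>
    have h1 := integral_permute_mul_update H (hF j (Finset.mem_insert_self j T))
      (hab j (Finset.mem_insert_self j T))
    -- The induction hypothesis is applied to the row already made to agree with `b` in column `j`,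
    -- which leaves the other columns of `T` untouched.
    have h2 := ih (fun i hi => hF i (Finset.mem_insert_of_mem hi))
      (a := Function.update a j (b j)) (fun i hi => by
        have : i ≠ j := by rintro rfl; exact hj hi
        rw [Function.update_of_ne this]
        exact hab i (Finset.mem_insert_of_mem hi))
    rw [h1, abs_mul, abs_neg, abs_of_pos hq'] at h2
    rw [Finset.card_insert_of_notMem hj, pow_succ _ T.card, ← mul_assoc, ← div_eq_mul_inv,
      le_div_iff₀ hq', mul_comm]
    exact h2

/-! ### Laws of the points inside their cells -/

/-- The uniform distribution on the unit cube. -/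
noncomputable def cubeLaw (d : ℕ) : Measure (Fin d → ℝ) := Measure.pi fun _ => unifIco

instance cubeLawProb (d : ℕ) : IsProbabilityMeasure (cubeLaw d) := by
  unfold cubeLaw; infer_instance

theorem cubeLaw_eq_restrict (d : ℕ) : cubeLaw d = volume.restrict (cube d) := by
  rw [cubeLaw, cube, volume_pi, Measure.restrict_pi_pi]
  rfl

theorem measurableSet_cube (d : ℕ) : MeasurableSet (cube d) :=
  MeasurableSet.univ_pi fun _ => measurableSet_Ico

theorem ae_mem_cube (d : ℕ) : ∀ᵐ x ∂cubeLaw d, x ∈ cube d := by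
  rw [cubeLaw_eq_restrict]
  exact ae_restrict_mem (measurableSet_cube d)

theorem measurePreserving_eval_pair {ι : Type*} [Fintype ι] {α : ι → Type*}
    [∀ i, MeasurableSpace (α i)] (μ : ∀ i, Measure (α i)) [∀ i, IsProbabilityMeasure (μ i)]
    {i j : ι} (hij : i ≠ j) :
    MeasurePreserving (fun x : ∀ i, α i => (x i, x j)) (Measure.pi μ) ((μ i).prod (μ j)) := by
  refine ⟨by fun_prop, ?_⟩
  have h : iIndepFun (fun i (x : ∀ i, α i) => x i) (Measure.pi μ) :=
    iIndepFun_pi (X := fun _ x => x) fun i => aemeasurable_id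
  rw [(indepFun_iff_map_prod_eq_prod_map_map (measurable_pi_apply i).aemeasurable
    (measurable_pi_apply j).aemeasurable).mp (h.indepFun hij)]
  congr
  · exact (measurePreserving_eval μ i).map_eq
  · exact (measurePreserving_eval μ j).map_eq

/-- Regroups (digits, digits) × (jitters, jitters) for two rows into one (digits, jitters) factor
per row. -/
theorem measurePreserving_prodProdProdComm {α β γ δ : Type*} [MeasurableSpace α]
    [MeasurableSpace β] [MeasurableSpace γ] [MeasurableSpace δ] (μ : Measure α) (ν : Measure β)
    (κ : Measure γ) (ρ : Measure δ) [SFinite μ] [SFinite ν] [SFinite κ] [SFinite ρ] :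
    MeasurePreserving (fun w : (α × β) × (γ × δ) => ((w.1.1, w.2.1), (w.1.2, w.2.2)))
      ((μ.prod ν).prod (κ.prod ρ)) ((μ.prod κ).prod (ν.prod ρ)) := by
  have h1 := measurePreserving_prodAssoc μ ν (κ.prod ρ)
  have h2 := (MeasurePreserving.id μ).prod ((measurePreserving_prodAssoc ν κ ρ).symm)
  have h3 := (MeasurePreserving.id μ).prod
    ((Measure.measurePreserving_swap (μ := ν) (ν := κ)).prod (MeasurePreserving.id ρ))
  have h4 := (MeasurePreserving.id μ).prod (measurePreserving_prodAssoc κ ν ρ)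
  have h5 := (measurePreserving_prodAssoc μ κ (ν.prod ρ)).symm
  exact h5.comp (h4.comp (h3.comp (h2.comp h1)))

/-- Composing with a transposition on the left exchanges two values of `σ r`, so all `q` values are
equally likely. -/
theorem map_eval_unifPerm_singleton {q : ℕ} (r k : Fin q) :
    (unifPerm q).map (fun σ => σ r) {k} = (q : ENNReal)⁻¹ := by
  set ρ := (unifPerm q).map (fun σ => σ r)
  have hρ : IsProbabilityMeasure ρ := Measure.isProbabilityMeasure_map
    Measurable.of_discrete.aemeasurable
  have heq : ∀ l, ρ {l} = ρ {k} := by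
    intro l
    simp only [ρ]
    rw [Measure.map_apply .of_discrete (measurableSet_singleton _),
      Measure.map_apply .of_discrete (measurableSet_singleton _),
      ← (measurePreserving_mul_left_unifPerm (Equiv.swap k l)).measure_preimage
        MeasurableSet.of_discrete.nullMeasurableSet]
    congr 1
    ext σ
    simp [Equiv.swap_apply_eq_iff]
  have h1 : ∫⁻ _, 1 ∂ρ = 1 := by simp
  rw [lintegral_fintype] at h1
  simp only [heq, one_mul, Finset.sum_const, Finset.card_univ, Fintype.card_fin,
    nsmul_eq_mul] at h1
  exact ENNReal.eq_inv_of_mul_eq_one_left (by rwa [mul_comm])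

theorem unifIco_preimage_div {q : ℕ} [NeZero q] (k : Fin q) {B : Set ℝ} (hB : MeasurableSet B) :
    unifIco ((fun x : ℝ => ((k : ℕ) + x) / q) ⁻¹' B) =
      q * volume (B ∩ Set.Ico ((k : ℕ) / q : ℝ) (((k : ℕ) + 1) / q)) := by
  have hq : (0 : ℝ) < q := by exact_mod_cast NeZero.pos q
  rw [unifIco, Measure.restrict_apply (measurableSet_preimage (by fun_prop) hB)]
  have h1 : (fun x : ℝ => ((k : ℕ) + x) / q) ⁻¹' B ∩ Set.Ico 0 1 =
      (fun x : ℝ => (q : ℝ)⁻¹ * x) ⁻¹' ((fun x : ℝ => ((k : ℕ) / q : ℝ) + x) ⁻¹'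
        (B ∩ Set.Ico ((k : ℕ) / q : ℝ) (((k : ℕ) + 1) / q))) := by
    ext x
    have h2 : ((k : ℕ) / q : ℝ) + (q : ℝ)⁻¹ * x = ((k : ℕ) + x) / q := by ring
    simp only [Set.mem_inter_iff, Set.mem_preimage, h2, Set.mem_Ico]
    rw [div_le_div_iff_of_pos_right hq, div_lt_div_iff_of_pos_right hq]
    simp
  rw [h1, Real.volume_preimage_mul_left (inv_ne_zero hq.ne'), measure_preimage_add, inv_inv,
    abs_of_pos hq, ENNReal.ofReal_natCast]

/-- A uniform digit followed by a uniform remainder is uniform on the unit interval. -/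
theorem measurePreserving_digit_add {q : ℕ} [NeZero q] (r : Fin q) :
    MeasurePreserving (fun w : Equiv.Perm (Fin q) × ℝ => ((w.1 r : ℕ) + w.2 : ℝ) / q)
      ((unifPerm q).prod unifIco) unifIco := by
  have hm : Measurable fun w : Equiv.Perm (Fin q) × ℝ => ((w.1 r : ℕ) + w.2 : ℝ) / q :=
    measurable_from_prod_countable_right fun σ => by fun_prop
  refine ⟨hm, ?_⟩
  ext B hB
  rw [Measure.map_apply hm hB, Measure.prod_apply (hm hB)]
  have h1 : ∀ σ : Equiv.Perm (Fin q), unifIco (Prod.mk σ ⁻¹'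
      ((fun w : Equiv.Perm (Fin q) × ℝ => ((w.1 r : ℕ) + w.2 : ℝ) / q) ⁻¹' B)) =
      q * volume (B ∩ Set.Ico ((σ r : ℕ) / q : ℝ) (((σ r : ℕ) + 1) / q)) := fun σ =>
    unifIco_preimage_div (σ r) hB
  simp only [h1]
  -- Integrate over the digit `σ r` instead of `σ`: its mass `1/q` cancels the scaling factor `q`,
  -- and the `q` subintervals tile `[0,1)`.
  rw [← lintegral_map (μ := unifPerm q) (g := fun σ => σ r)
    (f := fun k : Fin q => q * volume (B ∩ Set.Ico ((k : ℕ) / q : ℝ) (((k : ℕ) + 1) / q)))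
    .of_discrete .of_discrete, lintegral_fintype]
  have hq0 : (q : ENNReal) ≠ 0 := by simp [NeZero.ne q]
  have h2 : ∀ k : Fin q, q * volume (B ∩ Set.Ico ((k : ℕ) / q : ℝ) (((k : ℕ) + 1) / q)) *
      (unifPerm q).map (fun σ => σ r) {k} =
      volume (B ∩ Set.Ico ((k : ℕ) / q : ℝ) (((k : ℕ) + 1) / q)) := by
    intro k
    rw [map_eval_unifPerm_singleton, mul_right_comm, ENNReal.mul_inv_cancel hq0 (by simp), one_mul]
  simp only [h2]
  rw [unifIco, Measure.restrict_apply hB, ← iUnion_Ico_div (q := q), Set.inter_iUnion,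
    measure_iUnion (fun k l hkl => (Ico_div_disjoint hkl).mono Set.inter_subset_right
      Set.inter_subset_right) (fun k => hB.inter measurableSet_Ico), tsum_fintype]

/-- The position of the point with digits `σ_j(r_j)` and remainders `x_j`. -/
noncomputable def digitPoint {q d : ℕ} (r : Fin d → Fin q)
    (w : (Fin d → Equiv.Perm (Fin q)) × (Fin d → ℝ)) : Fin d → ℝ :=
  fun j => ((w.1 j (r j) : ℕ) + w.2 j) / q

theorem measurePreserving_digitPoint {q d : ℕ} [NeZero q] (r : Fin d → Fin q) :
    MeasurePreserving (digitPoint r) ((symbolPermLaw q d).prod (cubeLaw d)) (cubeLaw d) := by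
  have h1 : MeasurePreserving
      (fun (x : Fin d → Equiv.Perm (Fin q) × ℝ) j => (((x j).1 (r j) : ℕ) + (x j).2 : ℝ) / q)
      (Measure.pi fun _ => (unifPerm q).prod unifIco) (cubeLaw d) :=
    measurePreserving_pi _ _ fun j => measurePreserving_digit_add (r j)
  have h2 := (measurePreserving_arrowProdEquivProdArrow (Equiv.Perm (Fin q)) ℝ (Fin d)
    (fun _ => unifPerm q) (fun _ => unifIco)).symm
  exact h1.comp h2

theorem measurePreserving_block {q d : ℕ} (k : Fin d → Fin q) :
    MeasurePreserving (fun (τ : Fin d → Fin q → Equiv.Perm (Fin q)) j => τ j (k j))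
      (blockPermLaw q d) (symbolPermLaw q d) :=
  measurePreserving_pi _ _ fun j => measurePreserving_eval (fun _ => unifPerm q) (k j)

/-- Rows with different symbols in every column read different, hence independent, block
permutations. -/
theorem measurePreserving_block_pair {q d : ℕ} {k l : Fin d → Fin q} (hkl : ∀ j, k j ≠ l j) :
    MeasurePreserving (fun τ : Fin d → Fin q → Equiv.Perm (Fin q) =>
        ((fun j => τ j (k j), fun j => τ j (l j)) :
          (Fin d → Equiv.Perm (Fin q)) × (Fin d → Equiv.Perm (Fin q))))
      (blockPermLaw q d) ((symbolPermLaw q d).prod (symbolPermLaw q d)) := by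
  have h1 : MeasurePreserving
      (fun (τ : Fin d → Fin q → Equiv.Perm (Fin q)) j => (τ j (k j), τ j (l j)))
      (blockPermLaw q d) (Measure.pi fun _ => (unifPerm q).prod (unifPerm q)) :=
    measurePreserving_pi _ _ fun j =>
      measurePreserving_eval_pair (fun _ : Fin q => unifPerm q) (hkl j)
  exact (measurePreserving_arrowProdEquivProdArrow (Equiv.Perm (Fin q)) (Equiv.Perm (Fin q))
    (Fin d) (fun _ => unifPerm q) (fun _ => unifPerm q)).comp h1

theorem measurePreserving_jitter {n d : ℕ} (i : Fin n) :
    MeasurePreserving (fun U : Fin n → Fin d → ℝ => U i) (jitterLaw n d) (cubeLaw d) :=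
  measurePreserving_eval (fun _ : Fin n => cubeLaw d) i

theorem measurePreserving_jitter_pair {n d : ℕ} {i j : Fin n} (hij : i ≠ j) :
    MeasurePreserving (fun U : Fin n → Fin d → ℝ => (U i, U j)) (jitterLaw n d)
      ((cubeLaw d).prod (cubeLaw d)) :=
  measurePreserving_eval_pair (fun _ : Fin n => cubeLaw d) hij

/-- The position inside its cell of the `i`-th point of an OA-based Latin hypercube. -/
noncomputable def latinPoint {n d q : ℕ} (k r : Fin d → Fin q) (i : Fin n)
    (w : (Fin d → Fin q → Equiv.Perm (Fin q)) × (Fin n → Fin d → ℝ)) : Fin d → ℝ :=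
  digitPoint r (fun j => w.1 j (k j), w.2 i)

theorem measurePreserving_latinPoint {n d q : ℕ} [NeZero q] (k r : Fin d → Fin q) (i : Fin n) :
    MeasurePreserving (latinPoint k r i) ((blockPermLaw q d).prod (jitterLaw n d)) (cubeLaw d) :=
  (measurePreserving_digitPoint r).comp
    ((measurePreserving_block k).prod (measurePreserving_jitter i))

/-- The ranks `r` and `s` are arbitrary: any fixed argument of a uniform permutation gives a uniform
digit, so the order in which equal symbols are numbered plays no role. -/
theorem measurePreserving_latinPoint_pair {n d q : ℕ} [NeZero q] {k l : Fin d → Fin q}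
    (hkl : ∀ j, k j ≠ l j) (r s : Fin d → Fin q) {i i' : Fin n} (hi : i ≠ i') :
    MeasurePreserving (fun w => (latinPoint k r i w, latinPoint l s i' w))
      ((blockPermLaw q d).prod (jitterLaw n d)) ((cubeLaw d).prod (cubeLaw d)) :=
  ((measurePreserving_digitPoint r).prod (measurePreserving_digitPoint s)).comp
    ((measurePreserving_prodProdProdComm (symbolPermLaw q d) (symbolPermLaw q d)
      (cubeLaw d) (cubeLaw d)).comp
    ((measurePreserving_block_pair hkl).prod (measurePreserving_jitter_pair hi)))

/-- The point of the cell of `a` with relative position `x`. -/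
noncomputable def inCell {q d : ℕ} (a : Fin d → Fin q) (x : Fin d → ℝ) : Fin d → ℝ :=
  fun j => ((a j : ℕ) + x j) / q

theorem integral_inCell {q d : ℕ} [NeZero q] (f : (Fin d → ℝ) → ℝ) (a : Fin d → Fin q) :
    ∫ x, f (inCell a x) ∂cubeLaw d = cellAvg f a 1 := by
  have hq : (0 : ℝ) < q := by exact_mod_cast NeZero.pos q
  set m : Fin d → ℝ := fun j => ((a j : ℕ) : ℝ) / q
  have h1 : ∀ x, (cube d).indicator (fun x => f (inCell a x)) x =
      (cell 1 a).indicator f (m + (q : ℝ)⁻¹ • x) := by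
    intro x
    have h2 : inCell a x = m + (q : ℝ)⁻¹ • x := by
      ext j
      simp only [inCell, m, Pi.add_apply, Pi.smul_apply, smul_eq_mul]
      ring
    rw [← h2]
    have h3 : inCell a x ∈ cell 1 a ↔ x ∈ cube d := by
      rw [mem_cell le_rfl, mem_cube]
      refine forall_congr' fun j => ?_
      simp only [Pi.one_apply, one_ne_zero, if_false, inCell, Set.mem_Ico]
      rw [div_le_div_iff_of_pos_right hq, div_lt_div_iff_of_pos_right hq]
      simp
    by_cases hx : x ∈ cube d
    · rw [Set.indicator_of_mem hx, Set.indicator_of_mem (h3.mpr hx)]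
    · rw [Set.indicator_of_notMem hx, Set.indicator_of_notMem (mt h3.mp hx)]
  rw [cubeLaw_eq_restrict, ← integral_indicator (measurableSet_cube d)]
  simp only [h1]
  rw [Measure.integral_comp_smul volume (fun y => (cell 1 a).indicator f (m + y)),
    integral_add_left_eq_self, integral_indicator (measurableSet_cell _ _), cellAvg_eq]
  simp [abs_of_pos hq]

/-! ### Second moments given the symbol permutations -/

theorem MeasurePreserving.integral_comp_measurable {α β : Type*} [MeasurableSpace α]
    [MeasurableSpace β] {μ : Measure α} {ν : Measure β} {φ : α → β} (h : MeasurePreserving φ μ ν)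
    {g : β → ℝ} (hg : Measurable g) : ∫ x, g (φ x) ∂μ = ∫ y, g y ∂ν := by
  rw [← h.map_eq, integral_map h.measurable.aemeasurable hg.aestronglyMeasurable]

theorem integrable_of_abs_le {α : Type*} [MeasurableSpace α] {μ : Measure α} [IsFiniteMeasure μ]
    {g : α → ℝ} (hg : Measurable g) {C : ℝ} (hC : ∀ᵐ x ∂μ, |g x| ≤ C) : Integrable g μ :=
  .of_bound hg.aestronglyMeasurable C hC

/-- `R` marks the possibly correlated pairs. At most `n * m` of them survive in the expanded square,
each bounded by `κ ^ 2`. -/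
theorem integral_sq_sum_le {Ω : Type*} [MeasurableSpace Ω] {Q : Measure Ω} [IsProbabilityMeasure Q]
    {n m : ℕ} {W : Fin n → Ω → ℝ} {κ : ℝ} (hκ : 0 ≤ κ) (hW : ∀ i, Measurable (W i))
    (hWκ : ∀ i, ∀ᵐ ω ∂Q, |W i ω| ≤ κ) (R : Fin n → Fin n → Prop) [∀ i, DecidablePred (R i)]
    (hR : ∀ i i', ¬ R i i' → ∫ ω, W i ω * W i' ω ∂Q = 0)
    (hm : ∀ i, (Finset.univ.filter (R i)).card ≤ m) :
    ∫ ω, (∑ i, W i ω) ^ 2 ∂Q ≤ n * (m * κ ^ 2) := by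
  have hbd : ∀ i i', ∀ᵐ ω ∂Q, ‖W i ω * W i' ω‖ ≤ κ ^ 2 := fun i i' => by
    filter_upwards [hWκ i, hWκ i'] with ω h1 h2
    rw [norm_mul, sq]
    exact mul_le_mul h1 h2 (norm_nonneg _) hκ
  have hint : ∀ i i', Integrable (fun ω => W i ω * W i' ω) Q := fun i i' =>
    integrable_of_abs_le ((hW i).mul (hW i')) (hbd i i')
  simp only [sq (∑ i, W i _), Finset.sum_mul_sum]
  rw [integral_finsetSum _ fun i _ => integrable_finsetSum _ fun i' _ => hint i i']
  simp only [integral_finsetSum _ fun i' _ => hint _ i']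
  calc ∑ i, ∑ i', ∫ ω, W i ω * W i' ω ∂Q ≤ ∑ _i : Fin n, m * κ ^ 2 := by
        refine Finset.sum_le_sum fun i _ => ?_
        rw [← Finset.sum_filter_add_sum_filter_not _ (R i),
          Finset.sum_eq_zero (s := Finset.univ.filter fun i' => ¬ R i i') fun i' hi' =>
            hR i i' (Finset.mem_filter.mp hi').2, add_zero]
        calc _ ≤ ∑ _i' ∈ Finset.univ.filter (R i), κ ^ 2 := by
              refine Finset.sum_le_sum fun i' _ => ?_
              have := norm_integral_le_of_norm_le_const (hbd i i')
              simp only [probReal_univ, mul_one] at this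
              exact (le_abs_self _).trans this
          _ ≤ m * κ ^ 2 := by
              rw [Finset.sum_const, nsmul_eq_mul]
              gcongr
              exact hm i
    _ = n * (m * κ ^ 2) := by simp

/-- Law of total variance: the difference is the mean of the conditional variances, which lies
between `0` and `ε`. -/
theorem abs_variance_prod_sub_le {Θ Ω : Type*} [MeasurableSpace Θ] [MeasurableSpace Ω] [Finite Θ]
    [MeasurableSingletonClass Θ] {P : Measure Θ} {Q : Measure Ω} [IsProbabilityMeasure P]
    [IsProbabilityMeasure Q] {Z : Θ → Ω → ℝ} {G : Θ → ℝ} {B ε : ℝ} (hZ : ∀ p, Measurable (Z p))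
    (hB : ∀ p ω, |Z p ω| ≤ B) (hG : ∀ p, ∫ ω, Z p ω ∂Q = G p)
    (hε : ∀ p, ∫ ω, (Z p ω - G p) ^ 2 ∂Q ≤ ε) :
    |variance (fun w : Θ × Ω => Z w.1 w.2) (P.prod Q) - ∫ p, (G p - ∫ p, G p ∂P) ^ 2 ∂P| ≤ ε := by
  have hZm : Measurable fun w : Θ × Ω => Z w.1 w.2 := measurable_from_prod_countable_right hZ
  have hint : Integrable (fun w : Θ × Ω => Z w.1 w.2) (P.prod Q) :=
    integrable_of_abs_le hZm (.of_forall fun w => hB _ _)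
  have hZi : ∀ p, Integrable (Z p) Q := fun p =>
    integrable_of_abs_le (hZ p) (.of_forall fun ω => hB p ω)
  set m := ∫ p, G p ∂P
  have hmean : ∫ w, Z w.1 w.2 ∂(P.prod Q) = m := by
    rw [integral_prod _ hint]
    simp only [hG, m]
  have hsq : ∀ (p : Θ) (c : ℝ), Integrable (fun ω => (Z p ω - c) ^ 2) Q := fun p c =>
    integrable_of_abs_le (C := (B + |c|) ^ 2) (by fun_prop) (.of_forall fun ω => by
      rw [abs_pow]
      exact pow_le_pow_left₀ (abs_nonneg _) ((abs_sub _ _).trans (by linarith [hB p ω])) 2)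
  have hsqp : Integrable (fun w : Θ × Ω => (Z w.1 w.2 - m) ^ 2) (P.prod Q) :=
    integrable_of_abs_le (C := (B + |m|) ^ 2) (by fun_prop) (.of_forall fun w => by
      rw [abs_pow]
      exact pow_le_pow_left₀ (abs_nonneg _) ((abs_sub _ _).trans (by linarith [hB w.1 w.2])) 2)
  have hinner : ∀ p, ∫ ω, (Z p ω - m) ^ 2 ∂Q = ∫ ω, (Z p ω - G p) ^ 2 ∂Q + (G p - m) ^ 2 := by
    intro p
    have h1 : ∀ ω, (Z p ω - m) ^ 2 =
        (Z p ω - G p) ^ 2 + (2 * (G p - m) * (Z p ω - G p) + (G p - m) ^ 2) := fun ω => by ring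
    have h2 : Integrable (fun ω => Z p ω - G p) Q := (hZi p).sub (integrable_const _)
    simp only [h1]
    have h3 : Integrable (fun ω => 2 * (G p - m) * (Z p ω - G p) + (G p - m) ^ 2) Q :=
      (h2.const_mul _).add (integrable_const _)
    rw [integral_add (hsq p _) h3,
      integral_add (h2.const_mul _) (integrable_const _), integral_const_mul,
      integral_sub (hZi p) (integrable_const _), hG]
    simp
  rw [variance_eq_integral hZm.aemeasurable, hmean, integral_prod _ hsqp]
  simp only [hinner]
  rw [integral_add .of_finite .of_finite, add_sub_cancel_right, abs_of_nonneg
    (integral_nonneg fun p => integral_nonneg fun ω => sq_nonneg _)]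
  calc _ ≤ ∫ _p, ε ∂P := integral_mono .of_finite .of_finite hε
    _ = ε := by simp

/-! ### Orthogonal arrays of strength two -/

theorem IsOrthogonalArray.permute {n d q t : ℕ} {A : Fin n → Fin d → Fin q}
    (hA : IsOrthogonalArray t A) (p : Fin d → Equiv.Perm (Fin q)) :
    IsOrthogonalArray t fun i => permute p (A i) := by
  obtain ⟨r, hr⟩ := hA
  refine ⟨r, fun col v => ?_⟩
  refine (congrArg Finset.card (Finset.filter_congr fun i _ => ?_)).trans
    (hr col fun s => (p (col s)).symm (v s))
  simp [_root_.permute, Equiv.eq_symm_apply]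

/-- The common count `r` is positive because row `0` exhibits some pair. So every pair occurs, and
`q ^ 2` rows for `q ^ 2` pairs leave no repetition. -/
theorem IsOrthogonalArray.bijective {d q : ℕ} [NeZero q] {A : Fin (q ^ 2) → Fin d → Fin q}
    (hA : IsOrthogonalArray 2 A) {j j' : Fin d} (hj : j ≠ j') :
    Function.Bijective fun i => (A i j, A i j') := by
  obtain ⟨r, hr⟩ := hA
  let col : Fin 2 ↪ Fin d := ⟨![j, j'], by
    intro a b hab
    fin_cases a <;> fin_cases b <;> simp_all [eq_comm]⟩
  have hr' : ∀ s t, (Finset.univ.filter fun i => A i j = s ∧ A i j' = t).card = r := by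
    intro s t
    rw [← hr col ![s, t]]
    congr 1
    ext i
    simp only [Finset.mem_filter, Finset.mem_univ, true_and, Fin.forall_fin_two]
    rfl
  have hcard : Fintype.card (Fin (q ^ 2)) = Fintype.card (Fin q × Fin q) := by simp [sq]
  refine (Fintype.bijective_iff_surjective_and_card _).mpr ⟨?_, hcard⟩
  rintro ⟨s, t⟩
  have h0 : 0 < r := by
    rw [← hr' (A 0 j) (A 0 j')]
    exact Finset.card_pos.mpr ⟨0, by simp⟩
  rw [← hr' s t] at h0
  obtain ⟨i, hi⟩ := Finset.card_pos.mp h0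
  exact ⟨i, by simpa using hi⟩

/-- Rows with the same symbol in column `j` are told apart by any second column, so each column
accounts for at most `q` of them. -/
theorem IsOrthogonalArray.card_share_le {d q : ℕ} [NeZero q] (hd : 2 ≤ d)
    {A : Fin (q ^ 2) → Fin d → Fin q} (hA : IsOrthogonalArray 2 A) (i : Fin (q ^ 2)) :
    (Finset.univ.filter fun i' => ∃ j, A i j = A i' j).card ≤ d * q := by
  have : Nontrivial (Fin d) := Fin.nontrivial_iff_two_le.mpr hd
  have h1 : (Finset.univ.filter fun i' => ∃ j, A i j = A i' j) ⊆
      Finset.univ.biUnion fun j => Finset.univ.filter fun i' => A i j = A i' j := by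
    intro i'
    simp
  refine (Finset.card_le_card h1).trans (Finset.card_biUnion_le.trans ?_)
  calc _ ≤ ∑ _j : Fin d, q := by
        refine Finset.sum_le_sum fun j _ => ?_
        obtain ⟨j', hj'⟩ := exists_ne j
        have h3 := Finset.card_le_card_of_injOn (s := Finset.univ.filter fun i' => A i j = A i' j)
          (t := (Finset.univ : Finset (Fin q))) (fun i' => A i' j') (by simp) ?_
        · simpa using h3
        · intro a ha b hb hab
          simp only [Finset.coe_filter, Finset.mem_univ, true_and, Set.mem_ofPred_eq] at ha hb
          exact (hA.bijective hj'.symm).1 (Prod.ext (ha.symm.trans hb) hab)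
    _ = d * q := by simp

/-! ### Randomly placed points in the cells of an orthogonal array -/

theorem measurable_inCell {q d : ℕ} (a : Fin d → Fin q) : Measurable (inCell a) := by
  unfold inCell
  fun_prop

theorem norm_inCell_sub_le {q d : ℕ} (a : Fin d → Fin q) {x y : Fin d → ℝ} (hx : x ∈ cube d)
    (hy : y ∈ cube d) : ‖inCell a x - inCell a y‖ ≤ (q : ℝ)⁻¹ := by
  rw [pi_norm_le_iff_of_nonneg (by positivity)]
  intro j
  have h1 := mem_cube.mp hx j
  have h2 := mem_cube.mp hy j
  simp only [Set.mem_Ico] at h1 h2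
  have h3 : (inCell a x - inCell a y) j = (x j - y j) * (q : ℝ)⁻¹ := by
    simp only [inCell, Pi.sub_apply]
    ring
  rw [h3, norm_mul, norm_inv, Real.norm_natCast]
  refine mul_le_of_le_one_left (by positivity) ?_
  rw [Real.norm_eq_abs, abs_le]
  constructor <;> linarith

theorem abs_sub_cellAvg_le {q d : ℕ} [NeZero q] {f : (Fin d → ℝ) → ℝ} {K : NNReal}
    (hK : LipschitzWith K f) {B : ℝ} (hB : ∀ x, |f x| ≤ B) (a : Fin d → Fin q) {x : Fin d → ℝ}
    (hx : x ∈ cube d) : |f (inCell a x) - cellAvg f a 1| ≤ K * (q : ℝ)⁻¹ := by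
  have hm : Measurable fun y => f (inCell a y) :=
    hK.continuous.measurable.comp (measurable_inCell a)
  have hi : Integrable (fun y => f (inCell a y)) (cubeLaw d) :=
    integrable_of_abs_le hm (.of_forall fun y => hB _)
  have h1 : f (inCell a x) - cellAvg f a 1 =
      ∫ y, (f (inCell a x) - f (inCell a y)) ∂cubeLaw d := by
    rw [integral_sub (integrable_const _) hi, integral_inCell]
    simp
  rw [h1]
  have h2 := norm_integral_le_of_norm_le_const (μ := cubeLaw d)
    (f := fun y => f (inCell a x) - f (inCell a y)) (C := K * (q : ℝ)⁻¹) ?_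
  · simpa using h2
  · filter_upwards [ae_mem_cube d] with y hy
    refine (hK.norm_sub_le _ _).trans ?_
    gcongr
    exact norm_inCell_sub_le a hx hy

/-- The mean and a variance bound for the average of `f` over points that are uniform in the cells
of an orthogonal array, and independent for rows that have no symbol in common. -/
theorem OA_conditional_moments {q d : ℕ} [NeZero q] (hd : 2 ≤ d) {f : (Fin d → ℝ) → ℝ} {K : NNReal}
    (hK : LipschitzWith K f) {B : ℝ} (hB : ∀ x, |f x| ≤ B)
    {M : Fin (q ^ 2) → Fin d → Fin q} (hM : IsOrthogonalArray 2 M)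
    {Ω : Type*} [MeasurableSpace Ω] {Q : Measure Ω} [IsProbabilityMeasure Q]
    {V : Fin (q ^ 2) → Ω → Fin d → ℝ} (hV : ∀ i, MeasurePreserving (V i) Q (cubeLaw d))
    (hVV : ∀ i i', (∀ j, M i j ≠ M i' j) →
      MeasurePreserving (fun ω => (V i ω, V i' ω)) Q ((cubeLaw d).prod (cubeLaw d))) :
    ∫ ω, ((q : ℝ) ^ 2)⁻¹ * ∑ i, f (inCell (M i) (V i ω)) ∂Q =
        ((q : ℝ) ^ 2)⁻¹ * ∑ i, cellAvg f (M i) 1 ∧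
      ∫ ω, (((q : ℝ) ^ 2)⁻¹ * ∑ i, f (inCell (M i) (V i ω)) -
        ((q : ℝ) ^ 2)⁻¹ * ∑ i, cellAvg f (M i) 1) ^ 2 ∂Q ≤ d * K ^ 2 * ((q : ℝ) ^ 3)⁻¹ := by
  have hq : (0 : ℝ) < q := by exact_mod_cast NeZero.pos q
  have hm : ∀ i, Measurable fun x => f (inCell (M i) x) := fun i =>
    hK.continuous.measurable.comp (measurable_inCell _)
  have hi : ∀ i, Integrable (fun x => f (inCell (M i) x)) (cubeLaw d) := fun i =>
    integrable_of_abs_le (hm i) (.of_forall fun y => hB _)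
  have hiV : ∀ i, Integrable (fun ω => f (inCell (M i) (V i ω))) Q := fun i =>
    integrable_of_abs_le ((hm i).comp (hV i).measurable) (.of_forall fun y => hB _)
  constructor
  · rw [integral_const_mul, integral_finsetSum _ fun i _ => hiV i]
    congr 1
    refine Finset.sum_congr rfl fun i _ => ?_
    rw [MeasurePreserving.integral_comp_measurable (hV i) (hm i), integral_inCell]
  · set F : Fin (q ^ 2) → (Fin d → ℝ) → ℝ := fun i x => f (inCell (M i) x) - cellAvg f (M i) 1
    have hF : ∀ i, Measurable (F i) := fun i => (hm i).sub measurable_const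
    have hF0 : ∀ i, ∫ x, F i x ∂cubeLaw d = 0 := fun i => by
      simp only [F]
      rw [integral_sub (hi i) (integrable_const _), integral_inCell]
      simp
    have key := integral_sq_sum_le (Q := Q) (W := fun i ω => F i (V i ω)) (κ := K * (q : ℝ)⁻¹)
      (m := d * q) (by positivity) (fun i => (hF i).comp (hV i).measurable)
      (fun i => (hV i).quasiMeasurePreserving.ae
        ((ae_mem_cube d).mono fun x hx => abs_sub_cellAvg_le hK hB (M i) hx))
      (fun i i' => ∃ j, M i j = M i' j) ?_ (hM.card_share_le hd)
    · have h1 : ∀ ω, (((q : ℝ) ^ 2)⁻¹ * ∑ i, f (inCell (M i) (V i ω)) -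
          ((q : ℝ) ^ 2)⁻¹ * ∑ i, cellAvg f (M i) 1) ^ 2 =
          (((q : ℝ) ^ 2)⁻¹) ^ 2 * (∑ i, F i (V i ω)) ^ 2 := by
        intro ω
        simp only [F, Finset.sum_sub_distrib]
        ring
      simp only [h1]
      rw [integral_const_mul]
      refine (mul_le_mul_of_nonneg_left key (by positivity)).trans_eq ?_
      push_cast
      field_simp
    · intro i i' h
      push Not at h
      have h2 := MeasurePreserving.integral_comp_measurable (hVV i i' h)
        (g := fun z => F i z.1 * F i' z.2)
        (((hF i).comp measurable_fst).mul ((hF i').comp measurable_snd))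
      rw [h2, integral_prod_mul, hF0, zero_mul]

/-! ### The contribution of the high-order ANOVA components -/

theorem le_one_of_mem_highOrder {d : ℕ} {u : Fin d → ℕ} (hu : u ∈ highOrder d) : u ≤ 1 :=
  (Finset.mem_Icc.mp (Finset.mem_filter.mp hu).1).2

theorem eq_zero_or_one_of_le_one {d : ℕ} {u : Fin d → ℕ} (hu : u ≤ 1) (j : Fin d) :
    u j = 0 ∨ u j = 1 := by
  have h : u j ≤ 1 := hu j
  omega

theorem anova_update_of_eq_zero {d q : ℕ} (f : (Fin d → ℝ) → ℝ) {u : Fin d → ℕ} {j : Fin d}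
    (hj : u j = 0) (a : Fin d → Fin q) (s : Fin q) :
    anova f (Function.update a j s) u = anova f a u := by
  refine anova_congr f fun i hi => ?_
  have : i ≠ j := by rintro rfl; exact hi hj
  rw [Function.update_of_ne this]

/-- Some coordinate is active in exactly one of `u` and `v`; the component using it averages to zero
over that digit while the other is constant in it. -/
theorem integral_anova_mul_anova_of_ne {d q : ℕ} [NeZero q] {f : (Fin d → ℝ) → ℝ}
    (hf : LocallyIntegrable f) {u v : Fin d → ℕ} (hu : u ≤ 1) (hv : v ≤ 1) (huv : u ≠ v)
    (a b : Fin d → Fin q) :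
    ∫ p, anova f (permute p a) u * anova f (permute p b) v ∂symbolPermLaw q d = 0 := by
  obtain ⟨j, hj⟩ := Function.ne_iff.mp huv
  rcases eq_zero_or_one_of_le_one hu j with h | h
  · have h' : v j = 1 := (eq_zero_or_one_of_le_one hv j).resolve_left fun h' => hj (h.trans h'.symm)
    simp only [mul_comm (anova f (permute _ a) u)]
    exact integral_permute_mul_eq_zero (F := fun a => anova f a v) (H := fun a => anova f a u)
      (sum_anova_update hf hv h') (anova_update_of_eq_zero f h) b a
  · have h' : v j = 0 := (eq_zero_or_one_of_le_one hv j).resolve_right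
      fun h' => hj (h.trans h'.symm)
    exact integral_permute_mul_eq_zero (F := fun a => anova f a u) (H := fun a => anova f a v)
      (sum_anova_update hf hu h) (anova_update_of_eq_zero f h') a b

theorem integral_anova_eq_zero {d q : ℕ} [NeZero q] {f : (Fin d → ℝ) → ℝ}
    (hf : LocallyIntegrable f) {u : Fin d → ℕ} (hu : u ≤ 1) {j : Fin d} (hj : u j = 1)
    (a : Fin d → Fin q) : ∫ p, anova f (permute p a) u ∂symbolPermLaw q d = 0 := by
  simpa using integral_permute_mul_eq_zero (F := fun a => anova f a u) (H := fun _ => 1)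
      (sum_anova_update hf hu hj) (fun _ _ => rfl) a a

/-- At least three columns are active and the rows agree in at most one, so they differ in at least
two active columns, and in at least three if they never agree. -/
theorem abs_integral_anova_mul_anova_le {d q : ℕ} [NeZero q] (hq : 2 ≤ q) {f : (Fin d → ℝ) → ℝ}
    (hf : LocallyIntegrable f) {C : ℝ} {u : Fin d → ℕ} (hu : u ∈ highOrder d)
    (hC : ∀ a : Fin d → Fin q, |anova f a u| ≤ C) {a b : Fin d → Fin q}
    (hab : ∀ j j', a j = b j → a j' = b j' → j = j') :
    |∫ p, anova f (permute p a) u * anova f (permute p b) u ∂symbolPermLaw q d| ≤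
      C ^ 2 * ((((q : ℝ) - 1)⁻¹) ^ 3 + if ∃ j, a j = b j then (((q : ℝ) - 1)⁻¹) ^ 2 else 0) := by
  have hu1 := le_one_of_mem_highOrder hu
  have hq' : (1 : ℝ) ≤ q - 1 := by
    have : (2 : ℝ) ≤ q := by exact_mod_cast hq
    linarith
  have hx0 : 0 ≤ ((q : ℝ) - 1)⁻¹ := by positivity
  have hx1 : ((q : ℝ) - 1)⁻¹ ≤ 1 := inv_le_one_of_one_le₀ hq'
  set S := Finset.univ.filter fun j => 1 ≤ u j
  have hS : 3 ≤ S.card := (Finset.mem_filter.mp hu).2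
  set T := S.filter fun j => a j ≠ b j
  have hT : ∀ j ∈ T, u j = 1 ∧ a j ≠ b j := by
    intro j hj
    have h1 := Finset.mem_filter.mp hj
    have h2 : 1 ≤ u j := (Finset.mem_filter.mp h1.1).2
    have h3 : u j ≤ 1 := hu1 j
    exact ⟨by omega, h1.2⟩
  refine (abs_integral_permute_mul_le hq (F := fun a => anova f a u) (H := fun a => anova f a u)
    hC hC T (fun j hj => sum_anova_update hf hu1 (hT j hj).1) fun j hj => (hT j hj).2).trans ?_
  refine mul_le_mul_of_nonneg_left ?_ (sq_nonneg C)
  have hcard : T.card + (S.filter fun j => ¬ a j ≠ b j).card = S.card :=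
    Finset.card_filter_add_card_filter_not _
  split_ifs with h
  · have h1 : (S.filter fun j => ¬ a j ≠ b j).card ≤ 1 := by
      refine Finset.card_le_one.mpr fun j hj j' hj' => hab j j' ?_ ?_
      · simpa using (Finset.mem_filter.mp hj).2
      · simpa using (Finset.mem_filter.mp hj').2
    have h2 : 2 ≤ T.card := by omega
    have h3 := pow_le_pow_of_le_one hx0 hx1 h2
    have h4 : 0 ≤ ((q : ℝ) - 1)⁻¹ ^ 3 := by positivity
    linarith
  · have h1 : (S.filter fun j => ¬ a j ≠ b j).card = 0 := by
      refine Finset.card_eq_zero.mpr (Finset.filter_eq_empty_iff.mpr fun j _ => ?_)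
      exact not_not.mpr fun hj => h ⟨j, hj⟩
    rw [add_zero]
    exact pow_le_pow_of_le_one hx0 hx1 (by omega)

/-- The part of the average of the cell means that comes from the high-order components. -/
noncomputable def highOrderSum {d q : ℕ} (f : (Fin d → ℝ) → ℝ) (A : Fin (q ^ 2) → Fin d → Fin q)
    (p : Fin d → Equiv.Perm (Fin q)) : ℝ :=
  ((q : ℝ) ^ 2)⁻¹ * ∑ i, ∑ u ∈ highOrder d, anova f (permute p (A i)) u

theorem abs_integral_highOrderSum_sq_sub_le {d q : ℕ} [NeZero q] (hd : 2 ≤ d) (hq : 2 ≤ q)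
    {f : (Fin d → ℝ) → ℝ} (hf : LocallyIntegrable f) {C : ℝ}
    (hC : ∀ u ∈ highOrder d, ∀ a : Fin d → Fin q, |anova f a u| ≤ C)
    {A : Fin (q ^ 2) → Fin d → Fin q} (hA : IsOrthogonalArray 2 A) :
    |∫ p, highOrderSum f A p ^ 2 ∂symbolPermLaw q d - ((q : ℝ) ^ 2)⁻¹ *
        ∑ u ∈ highOrder d, ∫ p, anova f (permute p (A 0)) u ^ 2 ∂symbolPermLaw q d| ≤
      (highOrder d).card * C ^ 2 * (8 + 4 * d) * ((q : ℝ) ^ 3)⁻¹ := by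
  have hq2 : (2 : ℝ) ≤ q := by exact_mod_cast hq
  have hq0 : (0 : ℝ) < q := by linarith
  set x : ℝ := ((q : ℝ) - 1)⁻¹
  have hx0 : 0 ≤ x := inv_nonneg.mpr (by linarith)
  -- Here `2 ≤ q` is needed. The powers `(2 / q) ^ 3` and `(2 / q) ^ 2` produce the `8` and the `4`
  -- in the constant.
  have hx : x ≤ 2 / q := by
    simp only [x]
    rw [inv_le_iff_one_le_mul₀ (by linarith), div_mul_eq_mul_div, le_div_iff₀ hq0]
    linarith
  let c : Fin (q ^ 2) → Fin (q ^ 2) → ℝ := fun i i' => ∑ u ∈ highOrder d,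
    ∫ p, anova f (permute p (A i)) u * anova f (permute p (A i')) u ∂symbolPermLaw q d
  have hsq : ∫ p, highOrderSum f A p ^ 2 ∂symbolPermLaw q d =
      (((q : ℝ) ^ 2)⁻¹) ^ 2 * ∑ i, ∑ i', c i i' := by
    simp only [highOrderSum, mul_pow]
    rw [integral_const_mul]
    congr 1
    simp only [sq (∑ i, ∑ u ∈ highOrder d, _), Finset.sum_mul_sum]
    rw [integral_finsetSum _ fun i _ => integrable_symbolPermLaw _]
    refine Finset.sum_congr rfl fun i _ => ?_
    rw [integral_finsetSum _ fun i _ => integrable_symbolPermLaw _]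
    refine Finset.sum_congr rfl fun i' _ => ?_
    rw [integral_finsetSum _ fun i _ => integrable_symbolPermLaw _]
    refine Finset.sum_congr rfl fun u hu => ?_
    rw [integral_finsetSum _ fun i _ => integrable_symbolPermLaw _]
    refine Finset.sum_eq_single_of_mem u hu fun v hv hvu => ?_
    exact integral_anova_mul_anova_of_ne hf (le_one_of_mem_highOrder hu)
      (le_one_of_mem_highOrder hv) hvu.symm _ _
  have hdiag : ∀ i, c i i =
      ∑ u ∈ highOrder d, ∫ p, anova f (permute p (A 0)) u ^ 2 ∂symbolPermLaw q d := by
    intro i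
    refine Finset.sum_congr rfl fun u _ => ?_
    simp only [← sq]
    exact integral_permute_eq (fun a => anova f a u ^ 2) _ _
  have hoff : ∀ i, ∀ i' ∈ Finset.univ.erase i, |c i i'| ≤ (highOrder d).card *
      (C ^ 2 * (x ^ 3 + if ∃ j, A i j = A i' j then x ^ 2 else 0)) := by
    intro i i' hi'
    refine (Finset.abs_sum_le_sum_abs _ _).trans ?_
    rw [← nsmul_eq_mul]
    refine Finset.sum_le_card_nsmul _ _ _ fun u hu => ?_
    refine abs_integral_anova_mul_anova_le hq hf hu (hC u hu) fun j j' hj hj' => ?_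
    by_contra hne
    exact Finset.ne_of_mem_erase hi' ((hA.bijective hne).1 (Prod.ext hj hj')).symm
  have hrow : ∀ i, ∑ i' ∈ Finset.univ.erase i, |c i i'| ≤ (highOrder d).card *
      (C ^ 2 * (q ^ 2 * x ^ 3 + d * q * x ^ 2)) := by
    intro i
    calc _ ≤ ∑ i' : Fin (q ^ 2), (highOrder d).card *
          (C ^ 2 * (x ^ 3 + if ∃ j, A i j = A i' j then x ^ 2 else 0)) := by
          refine (Finset.sum_le_sum (hoff i)).trans
            (Finset.sum_le_sum_of_subset_of_nonneg (Finset.erase_subset _ _) fun i' _ _ => ?_)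
          split_ifs <;> positivity
      _ = (highOrder d).card * (C ^ 2 * (q ^ 2 * x ^ 3 +
          (Finset.univ.filter fun i' => ∃ j, A i j = A i' j).card * x ^ 2)) := by
          rw [← Finset.mul_sum, ← Finset.mul_sum, Finset.sum_add_distrib, ← Finset.sum_filter]
          simp
      _ ≤ _ := by
          gcongr
          exact_mod_cast hA.card_share_le hd i
  have hsplit : ∑ i, ∑ i', c i i' = q ^ 2 *
      (∑ u ∈ highOrder d, ∫ p, anova f (permute p (A 0)) u ^ 2 ∂symbolPermLaw q d) +
      ∑ i, ∑ i' ∈ Finset.univ.erase i, c i i' := by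
    have : ∀ i, ∑ i', c i i' = c i i + ∑ i' ∈ Finset.univ.erase i, c i i' := fun i =>
      (Finset.add_sum_erase _ _ (Finset.mem_univ i)).symm
    simp only [this, Finset.sum_add_distrib, hdiag]
    simp
  have hE : |∑ i, ∑ i' ∈ Finset.univ.erase i, c i i'| ≤
      q ^ 2 * ((highOrder d).card * (C ^ 2 * (q ^ 2 * x ^ 3 + d * q * x ^ 2))) := by
    refine (Finset.abs_sum_le_sum_abs _ _).trans ?_
    refine (Finset.sum_le_card_nsmul _ _ _ fun i _ =>
      (Finset.abs_sum_le_sum_abs _ _).trans (hrow i)).trans_eq ?_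
    simp
  rw [hsq, hsplit]
  have h1 : ∀ s e : ℝ, (((q : ℝ) ^ 2)⁻¹) ^ 2 * (q ^ 2 * s + e) - ((q : ℝ) ^ 2)⁻¹ * s =
      (((q : ℝ) ^ 2)⁻¹) ^ 2 * e := by
    intro s e
    field_simp
    ring
  rw [h1, abs_mul, abs_of_nonneg (by positivity : (0 : ℝ) ≤ (((q : ℝ) ^ 2)⁻¹) ^ 2)]
  calc _ ≤ (((q : ℝ) ^ 2)⁻¹) ^ 2 *
        (q ^ 2 * ((highOrder d).card * (C ^ 2 * (q ^ 2 * (2 / q) ^ 3 + d * q * (2 / q) ^ 2)))) := by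
        refine (mul_le_mul_of_nonneg_left hE (by positivity)).trans ?_
        gcongr
    _ = _ := by
        field_simp
        ring

/-- The component depends on at most two columns, whose symbol pairs run once through all `q ^ 2`
possibilities; summing over one active digit already gives zero. -/
theorem sum_anova_eq_zero_of_low {d q : ℕ} [NeZero q] (hd : 2 ≤ d) {f : (Fin d → ℝ) → ℝ}
    (hf : LocallyIntegrable f) {u : Fin d → ℕ} (hu : u ≤ 1) (hu0 : u ≠ 0)
    (hlow : (Finset.univ.filter fun j => 1 ≤ u j).card ≤ 2)
    {A : Fin (q ^ 2) → Fin d → Fin q} (hA : IsOrthogonalArray 2 A) : ∑ i, anova f (A i) u = 0 := by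
  have : Nontrivial (Fin d) := Fin.nontrivial_iff_two_le.mpr hd
  obtain ⟨j, hj⟩ := Function.ne_iff.mp hu0
  have hj1 : u j = 1 := (eq_zero_or_one_of_le_one hu j).resolve_left hj
  set S := Finset.univ.filter fun j => 1 ≤ u j
  have hjS : j ∈ S := by simp [S, hj1]
  -- If `j` is the only active coordinate, any other column serves as `j'`.
  obtain ⟨j', hj', hsupp⟩ : ∃ j', j' ≠ j ∧ ∀ i, u i ≠ 0 → i = j ∨ i = j' := by
    have hcard : (S.erase j).card ≤ 1 := by
      rw [Finset.card_erase_of_mem hjS]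
      omega
    have hmem : ∀ i, u i ≠ 0 → i ≠ j → i ∈ S.erase j := fun i hi hij => by
      simp [S, hij]
      omega
    rcases (S.erase j).eq_empty_or_nonempty with h | ⟨j', h⟩
    · obtain ⟨j', hj'⟩ := exists_ne j
      refine ⟨j', hj', fun i hi => ?_⟩
      by_contra! hne
      have := hmem i hi hne.1
      simp [h] at this
    · refine ⟨j', Finset.ne_of_mem_erase h, fun i hi => ?_⟩
      by_cases hij : i = j
      · exact Or.inl hij
      · exact Or.inr (Finset.card_le_one.mp hcard i (hmem i hi hij) j' h)
  have h1 : ∀ i, anova f (A i) u =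
      anova f (Function.update (Function.update 0 j' (A i j')) j (A i j)) u := by
    intro i
    refine anova_congr f fun k hk => ?_
    rcases hsupp k hk with rfl | rfl
    · simp
    · simp [hj']
  simp only [h1]
  rw [Fintype.sum_bijective _ (hA.bijective hj'.symm) _ (fun z : Fin q × Fin q =>
      anova f (Function.update (Function.update 0 j' z.2) j z.1) u) fun i => rfl,
    Fintype.sum_prod_type_right]
  exact Finset.sum_eq_zero fun t _ => sum_anova_update hf hu hj1 (Function.update 0 j' t)

theorem mean_cellAvg_eq {d q : ℕ} [NeZero q] (hd : 2 ≤ d) {f : (Fin d → ℝ) → ℝ}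
    (hf : LocallyIntegrable f) {A : Fin (q ^ 2) → Fin d → Fin q} (hA : IsOrthogonalArray 2 A)
    (p : Fin d → Equiv.Perm (Fin q)) :
    ((q : ℝ) ^ 2)⁻¹ * ∑ i, cellAvg f (permute p (A i)) 1 =
      anova f (0 : Fin d → Fin q) 0 + highOrderSum f A p := by
  have hq : (q : ℝ) ≠ 0 := by exact_mod_cast NeZero.ne q
  have h1 : ∀ u ∈ Finset.Icc (0 : Fin d → ℕ) 1, u ∉ insert 0 (highOrder d) →
      ∑ i, anova f (permute p (A i)) u = 0 := by
    intro u hu hu'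
    rw [Finset.mem_insert, not_or] at hu'
    refine sum_anova_eq_zero_of_low hd hf (Finset.mem_Icc.mp hu).2 hu'.1 ?_ (hA.permute p)
    by_contra! h
    exact hu'.2 (Finset.mem_filter.mpr ⟨hu, h⟩)
  have h0 : (0 : Fin d → ℕ) ∉ highOrder d := by simp [highOrder]
  have hsub : insert 0 (highOrder d) ⊆ Finset.Icc (0 : Fin d → ℕ) 1 := by
    refine Finset.insert_subset (by simp) (Finset.filter_subset _ _)
  have h2 : ∀ i, anova f (permute p (A i)) 0 = anova f (0 : Fin d → Fin q) 0 := fun i =>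
    anova_congr f (by simp)
  simp only [← sum_anova]
  rw [Finset.sum_comm, ← Finset.sum_subset hsub h1, Finset.sum_insert h0, Finset.sum_comm, mul_add,
    highOrderSum]
  simp only [h2]
  simp [hq]

theorem integral_highOrderSum {d q : ℕ} [NeZero q] {f : (Fin d → ℝ) → ℝ}
    (hf : LocallyIntegrable f) (A : Fin (q ^ 2) → Fin d → Fin q) :
    ∫ p, highOrderSum f A p ∂symbolPermLaw q d = 0 := by
  simp only [highOrderSum]
  rw [integral_const_mul, integral_finsetSum _ fun i _ => integrable_symbolPermLaw _,
    Finset.sum_eq_zero, mul_zero]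
  intro i _
  rw [integral_finsetSum _ fun i _ => integrable_symbolPermLaw _]
  refine Finset.sum_eq_zero fun u hu => ?_
  obtain ⟨j, hj⟩ := Finset.card_pos.mp (by have := (Finset.mem_filter.mp hu).2; omega :
    0 < (Finset.univ.filter fun j => 1 ≤ u j).card)
  have hj : 1 ≤ u j := (Finset.mem_filter.mp hj).2
  have hu1 := le_one_of_mem_highOrder hu
  exact integral_anova_eq_zero hf hu1
    ((eq_zero_or_one_of_le_one hu1 j).resolve_left (by omega)) _

/-! ### The two sampling schemes -/

/-- Common to both schemes, which differ only in how the positions `V` inside the cells are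
generated. -/
theorem abs_variance_sub_integral_highOrderSum_sq_le {d q : ℕ} [NeZero q] (hd : 2 ≤ d)
    {f : (Fin d → ℝ) → ℝ} {K : NNReal} (hK : LipschitzWith K f) {B : ℝ} (hB : ∀ x, |f x| ≤ B)
    {A : Fin (q ^ 2) → Fin d → Fin q} (hA : IsOrthogonalArray 2 A)
    {Ω : Type*} [MeasurableSpace Ω] {Q : Measure Ω} [IsProbabilityMeasure Q]
    {V : (Fin d → Equiv.Perm (Fin q)) → Fin (q ^ 2) → Ω → Fin d → ℝ}
    (hV : ∀ p i, MeasurePreserving (V p i) Q (cubeLaw d))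
    (hVV : ∀ p i i', (∀ j, permute p (A i) j ≠ permute p (A i') j) →
      MeasurePreserving (fun ω => (V p i ω, V p i' ω)) Q ((cubeLaw d).prod (cubeLaw d))) :
    |variance (fun w : (Fin d → Equiv.Perm (Fin q)) × Ω =>
        ((q : ℝ) ^ 2)⁻¹ * ∑ i, f (inCell (permute w.1 (A i)) (V w.1 i w.2)))
        ((symbolPermLaw q d).prod Q) - ∫ p, highOrderSum f A p ^ 2 ∂symbolPermLaw q d| ≤
      d * K ^ 2 * ((q : ℝ) ^ 3)⁻¹ := by
  have hq : (0 : ℝ) < q := by exact_mod_cast NeZero.pos q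
  have hf : LocallyIntegrable f := hK.continuous.locallyIntegrable
  have key := abs_variance_prod_sub_le (P := symbolPermLaw q d) (Q := Q)
    (Z := fun p ω => ((q : ℝ) ^ 2)⁻¹ * ∑ i, f (inCell (permute p (A i)) (V p i ω)))
    (B := B) (fun p => ?_) (fun p ω => ?_)
    (fun p => (OA_conditional_moments hd hK hB (hA.permute p) (hV p) (hVV p)).1)
    (fun p => (OA_conditional_moments hd hK hB (hA.permute p) (hV p) (hVV p)).2)
  · simp only [mean_cellAvg_eq hd hf hA] at key
    rw [integral_add (integrable_const _) (integrable_symbolPermLaw _),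
      integral_highOrderSum hf] at key
    simpa using key
  · refine (Finset.measurable_sum _ fun i _ => ?_).const_mul _
    exact hK.continuous.measurable.comp ((measurable_inCell _).comp (hV p i).measurable)
  · rw [abs_mul, abs_of_nonneg (by positivity)]
    refine (mul_le_mul_of_nonneg_left ((Finset.abs_sum_le_sum_abs _ _).trans
      (Finset.sum_le_card_nsmul _ _ _ fun i _ => hB _)) (by positivity)).trans_eq ?_
    simp
    field_simp

theorem abs_sigmaSqOas_sub_le {d q : ℕ} [NeZero q] (hd : 2 ≤ d)
    {f : (Fin d → ℝ) → ℝ} {K : NNReal} (hK : LipschitzWith K f) {B : ℝ} (hB : ∀ x, |f x| ≤ B)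
    {A : Fin (q ^ 2) → Fin d → Fin q} (hA : IsOrthogonalArray 2 A) :
    |sigmaSqOas f A - ∫ p, highOrderSum f A p ^ 2 ∂symbolPermLaw q d| ≤
      d * K ^ 2 * ((q : ℝ) ^ 3)⁻¹ := by
  refine abs_variance_sub_integral_highOrderSum_sq_le hd hK hB hA (Q := jitterLaw (q ^ 2) d)
    (V := fun _ i U => U i) (fun _ i => measurePreserving_jitter i) fun p i i' h => ?_
  refine measurePreserving_jitter_pair ?_
  rintro rfl
  exact h ⟨0, by omega⟩ rfl

/-- Since `(k q + t + U) / q² = (k + (t + U) / q) / q`, the symbol `k` selects the cell and the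
Latin digit `t` only refines the position inside it. -/
theorem pointY_eq {n d q : ℕ} [NeZero q] (A : Fin n → Fin d → Fin q)
    (p : Fin d → Equiv.Perm (Fin q)) (τ : Fin d → Fin q → Equiv.Perm (Fin q))
    (U : Fin n → Fin d → ℝ) (i : Fin n) :
    pointY A p τ U i = inCell (permute p (A i)) (latinPoint (permute p (A i))
      (fun j => Fin.ofNat q (priorCount (randomizeSymbols A p) i j)) i (τ, U)) := by
  have hq : (q : ℝ) ≠ 0 := by exact_mod_cast NeZero.ne q
  ext j
  simp only [pointY, latinArray, inCell, latinPoint, digitPoint, permute, randomizeSymbols]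
  push_cast
  field_simp
  ring

theorem abs_sigmaSqOal_sub_le {d q : ℕ} [NeZero q] (hd : 2 ≤ d)
    {f : (Fin d → ℝ) → ℝ} {K : NNReal} (hK : LipschitzWith K f) {B : ℝ} (hB : ∀ x, |f x| ≤ B)
    {A : Fin (q ^ 2) → Fin d → Fin q} (hA : IsOrthogonalArray 2 A) :
    |sigmaSqOal f A - ∫ p, highOrderSum f A p ^ 2 ∂symbolPermLaw q d| ≤
      d * K ^ 2 * ((q : ℝ) ^ 3)⁻¹ := by
  simp only [sigmaSqOal, pointY_eq]
  refine abs_variance_sub_integral_highOrderSum_sq_le hd hK hB hA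
    (Q := (blockPermLaw q d).prod (jitterLaw (q ^ 2) d))
    (V := fun p i => latinPoint (permute p (A i))
      (fun j => Fin.ofNat q (priorCount (randomizeSymbols A p) i j)) i)
    (fun p i => measurePreserving_latinPoint _ _ i) fun p i i' h => ?_
  refine measurePreserving_latinPoint_pair h _ _ ?_
  rintro rfl
  exact h ⟨0, by omega⟩ rfl

/-! ### Only the values on the cube matter -/

theorem inCell_mem_cube {q d : ℕ} [NeZero q] (a : Fin d → Fin q) {x : Fin d → ℝ}
    (hx : x ∈ cube d) : inCell a x ∈ cube d := by
  have hq : (0 : ℝ) < q := by exact_mod_cast NeZero.pos q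
  refine cell_subset_cube le_rfl a ((mem_cell le_rfl).mpr fun j => ?_)
  have := mem_cube.mp hx j
  simp only [Set.mem_Ico] at this
  simp only [Pi.one_apply, one_ne_zero, if_false, inCell, Set.mem_Ico]
  rw [div_le_div_iff_of_pos_right hq, div_lt_div_iff_of_pos_right hq]
  constructor <;> linarith

theorem sigmaSqOas_congr {d q : ℕ} [NeZero q] {f g : (Fin d → ℝ) → ℝ}
    (h : Set.EqOn f g (cube d)) (A : Fin (q ^ 2) → Fin d → Fin q) :
    sigmaSqOas f A = sigmaSqOas g A := by
  refine variance_congr ?_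
  have h1 : ∀ i, ∀ᵐ w ∂((symbolPermLaw q d).prod (jitterLaw (q ^ 2) d)), w.2 i ∈ cube d :=
    fun i => ((measurePreserving_jitter i).comp
      measurePreserving_snd).quasiMeasurePreserving.ae (ae_mem_cube d)
  filter_upwards [ae_all_iff.mpr h1] with w hw
  congr 1
  exact Finset.sum_congr rfl fun i _ => h (inCell_mem_cube _ (hw i))

theorem sigmaSqOal_congr {d q : ℕ} [NeZero q] {f g : (Fin d → ℝ) → ℝ}
    (h : Set.EqOn f g (cube d)) (A : Fin (q ^ 2) → Fin d → Fin q) :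
    sigmaSqOal f A = sigmaSqOal g A := by
  refine variance_congr ?_
  have h1 : ∀ i, ∀ᵐ w ∂((symbolPermLaw q d).prod ((blockPermLaw q d).prod (jitterLaw (q ^ 2) d))),
      w.2.2 i ∈ cube d :=
    fun i => ((measurePreserving_jitter i).comp
      (measurePreserving_snd.comp measurePreserving_snd)).quasiMeasurePreserving.ae (ae_mem_cube d)
  filter_upwards [ae_all_iff.mpr h1] with w hw
  congr 1
  refine Finset.sum_congr rfl fun i _ => ?_
  rw [pointY_eq]
  -- One application for each of the two digits: `latinPoint` is itself of the form `inCell`.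
  refine h (inCell_mem_cube _ (inCell_mem_cube _ (hw i)))

theorem proposition1 (d : ℕ) (hd : 2 ≤ d) (f : (Fin d → ℝ) → ℝ)
    (hf : SmoothLipschitzMixedPartial f) :
    ∃ (C : ℝ) (q₀ : ℕ), ∀ (q : ℕ) [NeZero q], q₀ ≤ q →
      ∀ A : Matrix (Fin (q ^ 2)) (Fin d) (Fin q), IsOrthogonalArray 2 A →
        |sigmaSqOal f A - ((q : ℝ) ^ 2)⁻¹ *
            ∑ u ∈ highOrder d, ∫ p, nuStar f A p 0 u ^ 2 ∂(symbolPermLaw q d)|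
          ≤ C * ((q : ℝ) ^ 3)⁻¹ ∧
        |sigmaSqOas f A - sigmaSqOal f A| ≤ C * ((q : ℝ) ^ 3)⁻¹ ∧
        |sigmaSqProxy f A - sigmaSqOal f A| ≤ C * ((q : ℝ) ^ 3)⁻¹ := by
  obtain ⟨g, K, B, hK, hB, hfg⟩ := hf.exists_extension (by omega)
  have hg : LocallyIntegrable g := hK.continuous.locallyIntegrable
  choose C hC using exists_abs_anova_le hB
  -- Nonnegativity of `C u` is read off from the bound at `q = 1`.
  have hC0 : ∀ u, 0 ≤ C u := fun u => (abs_nonneg _).trans (hC u 1 0)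
  set C₁ := ∑ u ∈ highOrder d, C u
  set E₁ : ℝ := (highOrder d).card * C₁ ^ 2 * (8 + 4 * d)
  set E₂ : ℝ := d * K ^ 2
  have hE₁ : 0 ≤ E₁ := by positivity
  have hE₂ : 0 ≤ E₂ := by positivity
  -- `E₁` comes from expanding `σ²`. Each sampling variance is within `E₂ q⁻³` of `σ²`, so the two
  -- differ by at most `2 E₂ q⁻³`.
  refine ⟨E₁ + 2 * E₂, 2, fun q _ hq A hA => ?_⟩
  have hnu : ∀ u ∈ highOrder d, ∀ p i, nuStar f A p i u = anova g (permute p (A i)) u :=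
    fun u hu p i => anova_congr_fun hfg (permute p (A i)) (le_one_of_mem_highOrder hu)
  have hmain := abs_integral_highOrderSum_sq_sub_le hd hq hg (C := C₁) (fun u hu a =>
    (hC u q a).trans (Finset.single_le_sum (fun v _ => hC0 v) hu)) hA
  have hproxy : sigmaSqProxy f A = ∫ p, highOrderSum g A p ^ 2 ∂symbolPermLaw q d := by
    refine integral_congr_ae (.of_forall fun p => ?_)
    simp only [highOrderSum]
    congr 2
    exact Finset.sum_congr rfl fun i _ => Finset.sum_congr rfl fun u hu => hnu u hu p i
  have hlead : ∑ u ∈ highOrder d, ∫ p, nuStar f A p 0 u ^ 2 ∂symbolPermLaw q d =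
      ∑ u ∈ highOrder d, ∫ p, anova g (permute p (A 0)) u ^ 2 ∂symbolPermLaw q d :=
    Finset.sum_congr rfl fun u hu => by simp only [hnu u hu]
  have hoas : sigmaSqOas f A = sigmaSqOas g A := sigmaSqOas_congr hfg A
  have hoal : sigmaSqOal f A = sigmaSqOal g A := sigmaSqOal_congr hfg A
  obtain ⟨h1, h1'⟩ := abs_le.mp (abs_sigmaSqOas_sub_le hd hK hB hA)
  obtain ⟨h2, h2'⟩ := abs_le.mp (abs_sigmaSqOal_sub_le hd hK hB hA)
  obtain ⟨h3, h3'⟩ := abs_le.mp hmain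
  rw [hoas, hoal, hlead, hproxy]
  have hq3 : 0 ≤ ((q : ℝ) ^ 3)⁻¹ := by positivity
  have h4 := mul_nonneg hE₁ hq3
  have h5 := mul_nonneg hE₂ hq3
  rw [abs_le, abs_le, abs_le, add_mul, mul_assoc 2]
  refine ⟨⟨?_, ?_⟩, ⟨?_, ?_⟩, ⟨?_, ?_⟩⟩ <;> linarith
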